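/- Let $K$ be a field with $\operatorname{char} K\neq 2,3$, let $E$ be an elliptic curve over $K$, and let $P\in E(K)$ be a point of infinite order. Suppose that $P$ is magnified by tripling a point, i.e. there are a finite extension $L/K$ with $[L:K]<9$ and a point $R\in E(L)$ with $3R=P$. Then at least one of the following holds: 1. $P$ is $K$-magnified, i.e. there are an elliptic curve $E'$ over $K$, an isogeny $\varphi:E'\to E$ defined over $K$ with $\deg\varphi>1$, and a point $Q\in E'(K)$ with $\varphi(Q)=P$; 2. $E$ has a non-trivial $K$-rational $3$-torsion point, i.e. there is $T\in E(K)$ with $T\neq\mathcal O$ and $3T=\mathcal O$. -/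

import Mathlib

open WeierstrassCurve

universe u

namespace EllIsog

section Curve

variable {K : Type u} [Field K] (E : WeierstrassCurve K)

/-- Homogeneous coordinates `[X : Y : Z]` of a point: `[x : y : 1]` for an affine point `(x, y)`,
and `[0 : 1 : 0]` for the point at infinity. -/
def projCoords {F : Type*} [Field F] {W : WeierstrassCurve F} : W.toAffine.Point → Fin 3 → F
  | .zero => ![0, 1, 0]
  | .some x y _ => ![x, y, 1]

/-- The element `(x, y, 1)` of `K(E)³`, where `x` and `y` are the Weierstrass coordinate functions
of `E`, i.e. the generic point of `E`. -/
noncomputable def genericCoords : Fin 3 → E.toAffine.FunctionField :=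
  ![algebraMap E.toAffine.CoordinateRing _ (Affine.CoordinateRing.mk E.toAffine
      (Polynomial.C Polynomial.X)),
    algebraMap E.toAffine.CoordinateRing _ (Affine.CoordinateRing.mk E.toAffine Polynomial.X),
    1]

/-- `HasValueAt E h Q v`: the rational function `h ∈ K(E)` is regular at the point `Q ∈ E(F)`, and
its value there is `v`. That is, `h` is the restriction to `E` of a quotient `A / B` of two
homogeneous polynomials in `K[X, Y, Z]` of the same degree with `B(Q) ≠ 0` and
`A(Q) / B(Q) = v`. The case in which `Q` is the point at infinity is included. -/
def HasValueAt {F : Type*} [Field F] [Algebra K F] (h : E.toAffine.FunctionField)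
    (Q : (E.baseChange F).toAffine.Point) (v : F) : Prop :=
  ∃ (n : ℕ) (A B : MvPolynomial (Fin 3) K), A.IsHomogeneous n ∧ B.IsHomogeneous n ∧
    MvPolynomial.aeval (genericCoords E) B ≠ 0 ∧
    h = MvPolynomial.aeval (genericCoords E) A / MvPolynomial.aeval (genericCoords E) B ∧
    MvPolynomial.aeval (projCoords Q) B ≠ 0 ∧
    v = MvPolynomial.aeval (projCoords Q) A / MvPolynomial.aeval (projCoords Q) B

end Curve

/-- An isogeny `φ : E' → E` defined over `K`: a non-constant morphism of curves over `K` that sends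
the point at infinity to the point at infinity. It is given by its map on geometric points and by
the homomorphism `φ^* : K(E) → K(E')`, `h ↦ h ∘ φ`; being a morphism means that whenever `h` is
regular at `φ(Q)`, its pull-back `φ^* h` is regular at `Q`, with the value `h(φ(Q))`.
(Non-constancy is the existence of `φ^*` on the whole function field. Morphisms of elliptic
curves that preserve the points at infinity are automatically group homomorphisms. Separability
is not required.) -/
structure Isogeny {K : Type u} [Field K] (E' E : WeierstrassCurve K) where
  /-- the map `E'(K̄) → E(K̄)` on geometric points -/
  toFun : (E'.baseChange (AlgebraicClosure K)).toAffine.Point →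
    (E.baseChange (AlgebraicClosure K)).toAffine.Point
  /-- the comorphism `φ^* : K(E) → K(E')` on function fields -/
  pullback : E.toAffine.FunctionField →ₐ[K] E'.toAffine.FunctionField
  regular : ∀ (Q : (E'.baseChange (AlgebraicClosure K)).toAffine.Point)
    (h : E.toAffine.FunctionField) (v : AlgebraicClosure K),
    HasValueAt E h (toFun Q) v → HasValueAt E' (pullback h) Q v
  map_zero : toFun 0 = 0

/-- The degree `[K(E') : φ^* K(E)]` of an isogeny `φ : E' → E`. -/
noncomputable def Isogeny.degree {K : Type u} [Field K] {E' E : WeierstrassCurve K}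
    (φ : Isogeny E' E) : ℕ :=
  Module.finrank φ.pullback.fieldRange E'.toAffine.FunctionField

open Classical in
/-- `P ∈ E(K)` is `K`-magnified: there are an elliptic curve `E'` over `K`, an isogeny
`φ : E' → E` defined over `K` with `1 = [K : K] < deg φ`, and a point `Q ∈ E'(K)` with
`φ(Q) = P`. -/
def IsKMagnified {K : Type u} [Field K] (E : WeierstrassCurve K)
    (P : (E.baseChange K).toAffine.Point) : Prop :=
  ∃ (E' : WeierstrassCurve K) (_ : E'.IsElliptic) (φ : Isogeny E' E)
    (Q : (E'.baseChange K).toAffine.Point), 1 < φ.degree ∧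
    φ.toFun (Affine.Point.baseChange K (AlgebraicClosure K) Q) =
      Affine.Point.baseChange K (AlgebraicClosure K) P

open Classical in
/-- `P ∈ E(K)` is magnified by tripling a point: there are a finite extension `L / K` with
`[L : K] < 9 = deg [3]` and a point `R ∈ E(L)` with `3R = P`. -/
def IsMagnifiedByTripling {K : Type u} [Field K] (E : WeierstrassCurve K)
    (P : (E.baseChange K).toAffine.Point) : Prop :=
  ∃ (L : Type u) (_ : Field L) (_ : Algebra K L), FiniteDimensional K L ∧ Module.finrank K L < 9 ∧
    ∃ R : (E.baseChange L).toAffine.Point, 3 • R = Affine.Point.baseChange K L P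

end EllIsog

namespace EllIsog

/-! The solutions of 3R = P over a field form a coset of the 3-torsion there, which has at most nine
elements, and the conjugates of the given R form a Galois-stable set O of fewer than nine of them.
As char K ≠ 3 and 2P ≠ 0, the point R may be taken over a separable extension
(`exists_separable_trisection`), so that over the separable closure "Galois-fixed" means "rational".
Infinite order of P enters only through 2P ≠ 0.

Let n = #O (`exists_fixed_or_line`). If 3 ∤ n, a combination of ΣO and P is a rational trisection
and [3] magnifies P. If n = 3, then ΣO − P is a rational 3-torsion point; when it vanishes, O is a
line {R, R + T, R − T} with {T, −T} stable. If n = 6, there must be nine trisections, and the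
complement of O is a stable set of three. For a stable line, the quotient E → E/⟨T⟩ is rational and
collapses the line to one rational point, which the dual isogeny sends to 3R = P
(`isKMagnified_of_line`).

Both magnifying isogenies, [3] and the dual 3-isogeny, are explicit. With η = y + (a₁x + a₃)/2 the
curve is η² = g(x), and both maps have the shape (x, η) ↦ (num/den², η·fac/den³) of an `OddCover`.
`OddCover.exists_isogeny` turns such data into an isogeny, and `OddCover.one_lt_degree` uses deg num
≥ 3 to see that its degree exceeds 1. For the 3-isogeny, a 3-torsion point is a flex, which brings E
to the form η² = u³ + d(au + 1)² (`Flex`); the quotient curve has the same form. -/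

theorem _root_.MvPolynomial.IsHomogeneous.aeval_mul_left {σ R S : Type*} [CommSemiring R]
    [CommSemiring S] [Algebra R S] {p : MvPolynomial σ R} {n : ℕ} (hp : p.IsHomogeneous n) (c : S)
    (s : σ → S) :
    MvPolynomial.aeval (fun i => c * s i) p = c ^ n * MvPolynomial.aeval s p := by
  rw [MvPolynomial.aeval_def, MvPolynomial.aeval_def, MvPolynomial.eval₂_eq, MvPolynomial.eval₂_eq,
    Finset.mul_sum]
  refine Finset.sum_congr rfl fun d hd => ?_
  have hdeg : ∑ i ∈ d.support, d i = n := by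
    simpa [Finsupp.weight_apply, Finsupp.sum] using hp (MvPolynomial.mem_support_iff.mp hd)
  simp_rw [mul_pow, Finset.prod_mul_distrib, Finset.prod_pow_eq_pow_sum, hdeg]
  ring

/-! ### Calculus of values of rational functions at points -/

section Values

variable {K : Type u} [Field K] {E : WeierstrassCurve K} {F : Type*} [Field F] [Algebra K F]
  {Q : (E.baseChange F).toAffine.Point} {h h₁ h₂ : E.toAffine.FunctionField} {v v₁ v₂ : F}

theorem hasValueAt_algebraMap (Q : (E.baseChange F).toAffine.Point) (c : K) :
    HasValueAt E (algebraMap K _ c) Q (algebraMap K F c) :=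
  ⟨0, .C c, 1, MvPolynomial.isHomogeneous_C _ _, MvPolynomial.isHomogeneous_one _ _, by simp,
    by simp, by simp, by simp⟩

theorem HasValueAt.add (H₁ : HasValueAt E h₁ Q v₁) (H₂ : HasValueAt E h₂ Q v₂) :
    HasValueAt E (h₁ + h₂) Q (v₁ + v₂) := by
  obtain ⟨n, A, B, hA, hB, hB0, rfl, hBQ, rfl⟩ := H₁
  obtain ⟨m, A', B', hA', hB', hB0', rfl, hBQ', rfl⟩ := H₂
  refine ⟨n + m, A * B' + B * A', B * B', (hA.mul hB').add (hB.mul hA'), hB.mul hB', ?_, ?_, ?_, ?_⟩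
  · simpa using ⟨hB0, hB0'⟩
  · simp only [map_add, map_mul]; rw [div_add_div _ _ hB0 hB0']
  · simpa using ⟨hBQ, hBQ'⟩
  · simp only [map_add, map_mul]; rw [div_add_div _ _ hBQ hBQ']

theorem HasValueAt.mul (H₁ : HasValueAt E h₁ Q v₁) (H₂ : HasValueAt E h₂ Q v₂) :
    HasValueAt E (h₁ * h₂) Q (v₁ * v₂) := by
  obtain ⟨n, A, B, hA, hB, hB0, rfl, hBQ, rfl⟩ := H₁
  obtain ⟨m, A', B', hA', hB', hB0', rfl, hBQ', rfl⟩ := H₂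
  refine ⟨n + m, A * A', B * B', hA.mul hA', hB.mul hB', ?_, ?_, ?_, ?_⟩
  · simpa using ⟨hB0, hB0'⟩
  · simp only [map_mul]; rw [div_mul_div_comm]
  · simpa using ⟨hBQ, hBQ'⟩
  · simp only [map_mul]; rw [div_mul_div_comm]

theorem HasValueAt.inv (H : HasValueAt E h Q v) (h0 : h ≠ 0) (v0 : v ≠ 0) :
    HasValueAt E h⁻¹ Q v⁻¹ := by
  obtain ⟨n, A, B, hA, hB, hB0, rfl, hBQ, rfl⟩ := H
  rw [div_ne_zero_iff] at h0 v0
  exact ⟨n, B, A, hB, hA, h0.1, inv_div _ _, v0.1, inv_div _ _⟩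

theorem HasValueAt.div (H₁ : HasValueAt E h₁ Q v₁) (H₂ : HasValueAt E h₂ Q v₂) (h0 : h₂ ≠ 0)
    (v0 : v₂ ≠ 0) : HasValueAt E (h₁ / h₂) Q (v₁ / v₂) := by
  rw [div_eq_mul_inv, div_eq_mul_inv]
  exact H₁.mul (H₂.inv h0 v0)

theorem HasValueAt.pow (H : HasValueAt E h Q v) (n : ℕ) : HasValueAt E (h ^ n) Q (v ^ n) := by
  induction n with
  | zero => simpa using hasValueAt_algebraMap Q (1 : K)
  | succ n ih => rw [pow_succ, pow_succ]; exact ih.mul H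

theorem HasValueAt.const_mul (c : K) (H : HasValueAt E h Q v) :
    HasValueAt E (algebraMap K _ c * h) Q (algebraMap K F c * v) :=
  (hasValueAt_algebraMap Q c).mul H

theorem HasValueAt.sub (H₁ : HasValueAt E h₁ Q v₁) (H₂ : HasValueAt E h₂ Q v₂) :
    HasValueAt E (h₁ - h₂) Q (v₁ - v₂) := by
  have := H₁.add (H₂.const_mul (-1))
  simpa [sub_eq_add_neg] using this

theorem HasValueAt.aeval (H : HasValueAt E h Q v) (p : Polynomial K) :
    HasValueAt E (Polynomial.aeval h p) Q (Polynomial.aeval v p) := by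
  induction p using Polynomial.induction_on' with
  | add p q hp hq => rw [map_add, map_add]; exact hp.add hq
  | monomial n a =>
    rw [Polynomial.aeval_monomial, Polynomial.aeval_monomial]
    exact (H.pow n).const_mul a

theorem hasValueAt_mvAeval {σ : Type*} {s : σ → E.toAffine.FunctionField} {w : σ → F}
    (H : ∀ i, HasValueAt E (s i) Q (w i)) (p : MvPolynomial σ K) :
    HasValueAt E (MvPolynomial.aeval s p) Q (MvPolynomial.aeval w p) := by
  induction p using MvPolynomial.induction_on with
  | C a => simpa using hasValueAt_algebraMap Q a
  | add p q hp hq => rw [map_add, map_add]; exact hp.add hq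
  | mul_X p i hp => simp only [map_mul, MvPolynomial.aeval_X]; exact hp.mul (H i)

/-- A homomorphism of function fields is compatible with values at `Q` and `P` as soon as the
pull-back of the generic point of `E`, suitably scaled, specialises at `Q` to `P`. -/
theorem HasValueAt.pullback {E' : WeierstrassCurve K}
    (φ : E.toAffine.FunctionField →ₐ[K] E'.toAffine.FunctionField)
    {P : (E.baseChange F).toAffine.Point} {Q : (E'.baseChange F).toAffine.Point}
    {c : E'.toAffine.FunctionField} (hc : c ≠ 0) {l : F} (hl : l ≠ 0)
    (H : ∀ i, HasValueAt E' (c * φ (genericCoords E i)) Q (l * projCoords P i))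
    (hv : HasValueAt E h P v) : HasValueAt E' (φ h) Q v := by
  obtain ⟨n, A, B, hA, hB, hB0, rfl, hBQ, rfl⟩ := hv
  -- A and B are homogeneous of the same degree n, so the scalings contribute cⁿ and lⁿ to both and
  -- cancel in the quotient.
  have key : ∀ p : MvPolynomial (Fin 3) K, p.IsHomogeneous n →
      HasValueAt E' (c ^ n * φ (MvPolynomial.aeval (genericCoords E) p)) Q
        (l ^ n * MvPolynomial.aeval (projCoords P) p) := by
    intro p hp
    have := hasValueAt_mvAeval H p
    rwa [hp.aeval_mul_left, hp.aeval_mul_left, ← MvPolynomial.comp_aeval_apply] at this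
  have hcn := pow_ne_zero n hc
  have hln := pow_ne_zero n hl
  have := (key A hA).div (key B hB) (mul_ne_zero hcn (by simpa using hB0)) (mul_ne_zero hln hBQ)
  rwa [mul_div_mul_left _ _ hcn, mul_div_mul_left _ _ hln, ← map_div₀] at this

end Values

/-! ### Function field, generic point and comorphisms -/

section GenericPoint

variable {K : Type u} [Field K] (E : WeierstrassCurve K)

theorem aeval_genericCoords_zero (p : Polynomial K) :
    Polynomial.aeval (genericCoords E 0) p =
      algebraMap E.toAffine.CoordinateRing _ (algebraMap (Polynomial K) _ p) := by
  have : Polynomial.aeval (genericCoords E 0) =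
      ((IsScalarTower.toAlgHom K E.toAffine.CoordinateRing E.toAffine.FunctionField).comp
        (IsScalarTower.toAlgHom K (Polynomial K) E.toAffine.CoordinateRing)) := by
    ext
    simp [genericCoords]
  rw [this]
  rfl

theorem aeval_genericCoords_zero_eq_zero {p : Polynomial K}
    (hp : Polynomial.aeval (genericCoords E 0) p = 0) : p = 0 := by
  rw [aeval_genericCoords_zero] at hp
  have h1 := (FaithfulSMul.algebraMap_injective E.toAffine.CoordinateRing
    E.toAffine.FunctionField) (hp.trans (map_zero _).symm)
  exact (FaithfulSMul.algebraMap_injective (Polynomial K) E.toAffine.CoordinateRing)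
    (h1.trans (map_zero _).symm)

theorem eval₂_polynomial_eq_zero_iff {F : Type*} [Field F] [Algebra K F] (x y : F) :
    Polynomial.eval₂ (Polynomial.aeval (R := K) x : Polynomial K →+* _) y
      E.toAffine.polynomial = 0 ↔ (E.baseChange F).toAffine.Equation x y := by
  rw [Affine.equation_iff, ← sub_eq_zero (b := x ^ 3 + _ + _ + _), Affine.polynomial]
  simp only [Polynomial.eval₂_sub, Polynomial.eval₂_add, Polynomial.eval₂_mul,
    Polynomial.eval₂_pow, Polynomial.eval₂_X, Polynomial.eval₂_C]
  simp [add_mul, add_assoc]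

theorem equation_genericCoords :
    (E.baseChange E.toAffine.FunctionField).toAffine.Equation (genericCoords E 0)
      (genericCoords E 1) := by
  rw [← eval₂_polynomial_eq_zero_iff]
  have h := congrArg (algebraMap E.toAffine.CoordinateRing E.toAffine.FunctionField)
    (AdjoinRoot.eval₂_root E.toAffine.polynomial)
  rw [Polynomial.hom_eval₂, map_zero] at h
  have hof : (Polynomial.aeval (R := K) (genericCoords E 0) : Polynomial K →+* _) =
      (algebraMap E.toAffine.CoordinateRing E.toAffine.FunctionField).comp
        (AdjoinRoot.of E.toAffine.polynomial) :=
    RingHom.ext fun p => aeval_genericCoords_zero E p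
  rw [hof]
  exact h

/-- For h = n/m, the elements m², nm, n² of the coordinate ring are dependent over K[X], because
that ring is free of rank 2. Used to bound degrees from below in `OddCover.one_lt_degree`. -/
theorem exists_quadratic_relation (h : E.toAffine.FunctionField) :
    ∃ p : Fin 3 → Polynomial K, p ≠ 0 ∧
      ∑ i, Polynomial.aeval (genericCoords E 0) (p i) * h ^ (i : ℕ) = 0 := by
  obtain ⟨n, m, hm, rfl⟩ := IsFractionRing.div_surjective (A := E.toAffine.CoordinateRing) h
  have hm0 : algebraMap _ E.toAffine.FunctionField m ≠ 0 := by
    simpa using nonZeroDivisors.ne_zero hm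
  have hdep : ¬ LinearIndependent (Polynomial K) ![m ^ 2, n * m, n ^ 2] := by
    intro hli
    have : Module.Finite (Polynomial K) E.toAffine.CoordinateRing :=
      Module.Finite.of_basis (Affine.CoordinateRing.basis E.toAffine)
    have := hli.fintype_card_le_finrank
    rw [Module.finrank_eq_card_basis (Affine.CoordinateRing.basis E.toAffine)] at this
    simp at this
  rw [Fintype.not_linearIndependent_iff] at hdep
  obtain ⟨p, hp, i, hi⟩ := hdep
  refine ⟨p, fun h0 => hi (congrFun h0 i), ?_⟩
  have := congrArg (algebraMap _ E.toAffine.FunctionField) hp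
  simp only [Fin.sum_univ_three, Algebra.smul_def, map_add, map_mul, map_zero,
    ← aeval_genericCoords_zero] at this ⊢
  simp at this
  rw [← mul_left_inj' (pow_ne_zero 2 hm0), zero_mul, ← this]
  simp only [Fin.val_zero, Fin.val_one, Fin.val_two, pow_zero, pow_one, mul_one]
  field_simp

variable {E} {E' : WeierstrassCurve K}

theorem exists_pullback {x y : E'.toAffine.FunctionField}
    (hxy : (E.baseChange E'.toAffine.FunctionField).toAffine.Equation x y)
    (hx : ∀ p : Polynomial K, Polynomial.aeval x p = 0 → p = 0) :
    ∃ φ : E.toAffine.FunctionField →ₐ[K] E'.toAffine.FunctionField,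
      φ (genericCoords E 0) = x ∧ φ (genericCoords E 1) = y := by
  have hroot : Polynomial.eval₂ (Polynomial.aeval (R := K) x : Polynomial K →+* _) y
      E.toAffine.polynomial = 0 := (eval₂_polynomial_eq_zero_iff E x y).mpr hxy
  let f := AdjoinRoot.liftAlgHom E.toAffine.polynomial (Polynomial.aeval (R := K) x) y hroot
  have hfC : ∀ p : Polynomial K, f (algebraMap (Polynomial K) _ p) = Polynomial.aeval x p :=
    fun p => AdjoinRoot.liftAlgHom_of (h := hroot) ..
  have hf : Function.Injective f := by
    rw [RingHom.injective_iff_ker_eq_bot]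
    have : Module.Finite (Polynomial K) E.toAffine.CoordinateRing :=
      Module.Finite.of_basis (Affine.CoordinateRing.basis E.toAffine)
    -- The coordinate ring is a domain integral over K[X], so a nonzero kernel would meet K[X]; the
    -- transcendence of x excludes this.
    apply Ideal.eq_bot_of_comap_eq_bot (R := Polynomial K)
    rw [eq_bot_iff]
    intro p hp
    exact hx p ((hfC p).symm.trans hp)
  refine ⟨IsFractionRing.liftAlgHom (K := E.toAffine.FunctionField) hf, ?_, ?_⟩
  · have := hfC Polynomial.X
    simpa [genericCoords] using! this
  · have : f (AdjoinRoot.root _) = y := AdjoinRoot.liftAlgHom_root (h := hroot) ..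
    simpa [genericCoords] using! this

end GenericPoint

/-! ### Completing the square: η² = g(x) -/

section CentredForm

variable {F : Type*} [Field F]

/-- The coordinate `η = y + (a₁ x + a₃) / 2`, in which negation of points is `η ↦ -η`. -/
def centredY (W : WeierstrassCurve F) (x y : F) : F := y + (W.a₁ * x + W.a₃) / 2

/-- The cubic `g` for which the Weierstrass equation reads `η² = g(x)`. -/
def cubic (W : WeierstrassCurve F) (x : F) : F :=
  x ^ 3 + W.b₂ / 4 * x ^ 2 + W.b₄ / 2 * x + W.b₆ / 4

theorem equation_iff_centredY [NeZero (2 : F)] (W : WeierstrassCurve F) (x y : F) :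
    W.toAffine.Equation x y ↔ centredY W x y ^ 2 = cubic W x := by
  have h2 : (2 : F) ≠ 0 := two_ne_zero
  have h4 : (4 : F) ≠ 0 := by
    rw [show (4 : F) = 2 * 2 by norm_num]; exact mul_ne_zero h2 h2
  rw [Affine.equation_iff, centredY, cubic, b₂, b₄, b₆]
  field_simp
  constructor <;> intro h
  · linear_combination 16 * h
  · apply mul_left_cancel₀ (mul_ne_zero h4 h4)
    linear_combination h

end CentredForm

/-! ### Odd covers: maps (x, η) ↦ (num/den², η·fac/den³) -/

section Polynomials

open Polynomial

variable {K : Type u} [Field K]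

/-- The polynomial `g` over the base field for which the Weierstrass equation reads `η² = g(x)`. -/
noncomputable def cubicPoly (E : WeierstrassCurve K) : K[X] :=
  X ^ 3 + C (E.b₂ / 4) * X ^ 2 + C (E.b₄ / 2) * X + C (E.b₆ / 4)

theorem aeval_cubicPoly (E : WeierstrassCurve K) {F : Type*} [Field F] [Algebra K F] (x : F) :
    aeval x (cubicPoly E) = cubic (E.baseChange F) x := by
  simp [cubicPoly, cubic, WeierstrassCurve.baseChange, map_b₂, map_b₄, map_b₆, map_ofNat]

theorem natDegree_cubicPoly (E : WeierstrassCurve K) : (cubicPoly E).natDegree = 3 := by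
  unfold cubicPoly; compute_degree!

/-- Polynomials `num`, `den`, `fac` such that `(x, η) ↦ (num / den², η fac / den³)` maps `E'` to
`E`, where `η = y + (a₁ x + a₃) / 2`. -/
structure OddCover (E' E : WeierstrassCurve K) where
  num : K[X]
  den : K[X]
  fac : K[X]
  natDegree_num : num.natDegree = 2 * den.natDegree + 1
  natDegree_den : 1 ≤ den.natDegree
  coprime : IsCoprime num den
  equation : cubicPoly E' * fac ^ 2 = num ^ 3 + C (E.b₂ / 4) * num ^ 2 * den ^ 2 +
    C (E.b₄ / 2) * num * den ^ 4 + C (E.b₆ / 4) * den ^ 6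

namespace OddCover

variable {E' E : WeierstrassCurve K} (c : OddCover E' E)

theorem den_ne_zero : c.den ≠ 0 := by
  intro h; have := c.natDegree_den; simp [h] at this

theorem num_ne_zero : c.num ≠ 0 := by
  intro h; have := c.natDegree_num; simp [h] at this

/-- With d = deg den, the term num³ has degree 6d + 3 and the other terms on the right have degree
at most 6d + 2, so 3 + 2 deg fac = 6d + 3. This governs the behaviour at infinity. -/
theorem degree_fac : c.fac ≠ 0 ∧ c.fac.natDegree = 3 * c.den.natDegree := by
  have hn := c.natDegree_num
  have hd := c.natDegree_den
  have hbound : (C (E.b₂ / 4) * c.num ^ 2 * c.den ^ 2 + C (E.b₄ / 2) * c.num * c.den ^ 4 +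
      C (E.b₆ / 4) * c.den ^ 6).natDegree < (c.num ^ 3).natDegree := by
    rw [natDegree_pow, Nat.lt_iff_le_pred (by omega)]
    refine natDegree_add_le_of_degree_le (natDegree_add_le_of_degree_le ?_ ?_) ?_
    · rw [mul_assoc]
      refine (natDegree_C_mul_le _ _).trans ?_
      refine natDegree_mul_le.trans ?_
      rw [natDegree_pow, natDegree_pow]; omega
    · rw [mul_assoc]
      refine (natDegree_C_mul_le _ _).trans ?_
      refine natDegree_mul_le.trans ?_
      rw [natDegree_pow]; omega
    · refine (natDegree_C_mul_le _ _).trans ?_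
      rw [natDegree_pow]; omega
  have heq := c.equation
  rw [add_assoc, add_assoc, ← add_assoc (C (E.b₂ / 4) * _ * _)] at heq
  have hdeg := congrArg natDegree heq
  rw [natDegree_add_eq_left_of_natDegree_lt hbound, natDegree_pow] at hdeg
  have hf : c.fac ≠ 0 := by
    intro h
    rw [h] at hdeg
    simp at hdeg
    omega
  rw [natDegree_mul (by intro h; have := natDegree_cubicPoly E'; simp [h] at this)
    (pow_ne_zero 2 hf), natDegree_cubicPoly, natDegree_pow] at hdeg
  exact ⟨hf, by omega⟩

section Eval

variable {F : Type*} [Field F] [Algebra K F]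

/-- The `x`-coordinate of the image point. -/
noncomputable def mapX (x : F) : F := aeval x c.num / aeval x c.den ^ 2

/-- The `y`-coordinate of the image point. -/
noncomputable def mapY (x y : F) : F :=
  centredY (E'.baseChange F) x y * aeval x c.fac / aeval x c.den ^ 3 -
    ((E.baseChange F).a₁ * c.mapX x + (E.baseChange F).a₃) / 2

theorem centredY_map (x y : F) : centredY (E.baseChange F) (c.mapX x) (c.mapY x y) =
    centredY (E'.baseChange F) x y * aeval x c.fac / aeval x c.den ^ 3 := by
  rw [mapY]; exact sub_add_cancel _ _

theorem aeval_equation (x : F) : cubic (E'.baseChange F) x * aeval x c.fac ^ 2 =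
    aeval x c.num ^ 3 + (E.baseChange F).b₂ / 4 * aeval x c.num ^ 2 * aeval x c.den ^ 2 +
    (E.baseChange F).b₄ / 2 * aeval x c.num * aeval x c.den ^ 4 +
    (E.baseChange F).b₆ / 4 * aeval x c.den ^ 6 := by
  have := congrArg (aeval x) c.equation
  simpa [aeval_cubicPoly, WeierstrassCurve.baseChange, map_b₂, map_b₄, map_b₆, map_ofNat] using this

theorem equation_map [NeZero (2 : F)] {x y : F}
    (h : (E'.baseChange F).toAffine.Equation x y) (hx : aeval x c.den ≠ 0) :
    (E.baseChange F).toAffine.Equation (c.mapX x) (c.mapY x y) := by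
  rw [equation_iff_centredY] at h ⊢
  rw [centredY_map, div_pow, mul_pow, h, c.aeval_equation, cubic, mapX]
  field_simp

/-- Where den vanishes, the equation reduces to (η·fac)² = num³, and num is nonzero there by
coprimality. Hence zeros of den are sent to infinity. -/
theorem fac_ne_zero [NeZero (2 : F)] {x y : F} (h : (E'.baseChange F).toAffine.Equation x y)
    (hx : aeval x c.den = 0) : centredY (E'.baseChange F) x y * aeval x c.fac ≠ 0 := by
  rw [equation_iff_centredY] at h
  intro h0
  have h1 := c.aeval_equation x
  rw [← h, ← mul_pow, h0, hx] at h1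
  have h2 : aeval x c.num = 0 := by simpa using h1.symm
  obtain ⟨a, b, hab⟩ := c.coprime
  have := congrArg (aeval x) hab
  simp [hx, h2] at this

/-- Induction on a bound N for the degrees of the pᵢ. Clearing denominators shows that num divides
den^(2(N+1))·s, where s collects the constant terms of the pᵢ. Coprimality gives num ∣ s, and deg s
≤ 2 < deg num forces s = 0; the relation can then be divided by `c.mapX x`. -/
theorem eval_map_relation {x : F} (hx : ∀ p : K[X], aeval x p = 0 → p = 0) (N : ℕ) :
    ∀ p : Fin 3 → K[X], (∀ i, ∀ n ≥ N, (p i).coeff n = 0) →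
      (∑ i, aeval (c.mapX x) (p i) * x ^ (i : ℕ) = 0) → p = 0 := by
  have hd : aeval x c.den ≠ 0 := fun h => c.den_ne_zero (hx _ h)
  have hn : aeval x c.num ≠ 0 := fun h => c.num_ne_zero (hx _ h)
  have hclear : ∀ N, ∀ q : K[X], (∀ n ≥ N, q.coeff n = 0) →
      ∃ r : K[X], aeval x c.den ^ (2 * N) * aeval (c.mapX x) q = aeval x r := by
    intro N
    induction N with
    | zero =>
      intro q hq
      exact ⟨0, by rw [show q = 0 from Polynomial.ext fun n => hq n n.zero_le]; simp⟩
    | succ N ih =>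
      intro q hq
      obtain ⟨r, hr⟩ := ih q.divX fun n hn => by rw [coeff_divX]; exact hq _ (by omega)
      refine ⟨c.num * r + C (q.coeff 0) * c.den ^ (2 * (N + 1)), ?_⟩
      conv_lhs => rw [← divX_mul_X_add q]
      simp only [map_add, map_mul, aeval_X, aeval_C, map_pow, ← hr]
      rw [show c.mapX x = aeval x c.num / aeval x c.den ^ 2 from rfl]
      field_simp
      ring
  induction N with
  | zero => exact fun p hp _ => funext fun i => Polynomial.ext fun n => hp i n n.zero_le
  | succ N ih =>
    intro p hp hrel
    choose r hr using fun i => hclear N (p i).divX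
      fun n hn => by rw [coeff_divX]; exact hp i _ (by omega)
    have hsplit : ∀ i, aeval (c.mapX x) (p i) = c.mapX x * aeval (c.mapX x) (p i).divX +
        algebraMap K F ((p i).coeff 0) := by
      intro i
      conv_lhs => rw [← divX_mul_X_add (p i)]
      simp only [map_add, map_mul, aeval_X, aeval_C, mul_comm]
    set s : K[X] := ∑ i, C ((p i).coeff 0) * X ^ (i : ℕ) with hs
    have hpoly : c.num * ∑ i, r i * X ^ (i : ℕ) + c.den ^ (2 * (N + 1)) * s = 0 := by
      apply hx
      simp only [hs, Fin.sum_univ_three, map_add, map_mul, map_pow, aeval_X, aeval_C, ← hr,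
        hsplit] at hrel ⊢
      rw [show c.mapX x = aeval x c.num / aeval x c.den ^ 2 from rfl] at hrel ⊢
      rw [← mul_zero (aeval x c.den ^ (2 * (N + 1))), ← hrel]
      field_simp
      ring
    have hs0 : s = 0 := by
      have hdvd : c.num ∣ s := by
        refine (c.coprime.pow_right (n := 2 * (N + 1))).dvd_of_dvd_mul_left ?_
        exact ⟨-∑ i, r i * X ^ (i : ℕ), by linear_combination hpoly⟩
      refine eq_zero_of_dvd_of_natDegree_lt hdvd ?_
      have : s.natDegree ≤ 2 := by
        rw [hs, Fin.sum_univ_three]; simp only [Fin.val_zero, Fin.val_one, Fin.val_two]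
        compute_degree
      have := c.natDegree_num
      have := c.natDegree_den
      omega
    have hcoeff : ∀ i, (p i).coeff 0 = 0 := by
      have h : ∀ n, s.coeff n = 0 := fun n => by rw [hs0, coeff_zero]
      rw [hs, Fin.sum_univ_three] at h
      intro i
      have := h i
      fin_cases i <;> simpa [coeff_X, coeff_C, coeff_X_pow] using this
    have hdiv : (fun i => (p i).divX) = 0 := by
      refine ih _ (fun i n hn => by rw [coeff_divX]; exact hp i _ (by omega)) ?_
      have : c.mapX x ≠ 0 := div_ne_zero hn (pow_ne_zero 2 hd)
      apply mul_left_cancel₀ this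
      rw [mul_zero, ← hrel, Finset.mul_sum]
      refine Finset.sum_congr rfl fun i _ => ?_
      rw [hsplit, hcoeff, map_zero, add_zero, mul_assoc]
    funext i
    rw [← divX_mul_X_add (p i), hcoeff, show (p i).divX = 0 from congrFun hdiv i]
    simp

/-- Thus 1, x, x² are independent over K(`mapX x`): the extension K(x) of K(`mapX x`) has degree at
least 3. -/
theorem eq_zero_of_relation {x : F} (hx : ∀ p : K[X], aeval x p = 0 → p = 0) (p : Fin 3 → K[X])
    (h : ∑ i, aeval (c.mapX x) (p i) * x ^ (i : ℕ) = 0) : p = 0 := by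
  refine c.eval_map_relation hx (Finset.univ.sup (fun i => (p i).natDegree) + 1) p ?_ h
  intro i n hn
  refine coeff_eq_zero_of_natDegree_lt (lt_of_lt_of_le (Nat.lt_succ_of_le ?_) hn)
  exact Finset.le_sup (f := fun i => (p i).natDegree) (Finset.mem_univ i)

theorem eq_zero_of_aeval_mapX {x : F} (hx : ∀ p : K[X], aeval x p = 0 → p = 0) (p : K[X])
    (h : aeval (c.mapX x) p = 0) : p = 0 := by
  have := c.eq_zero_of_relation hx ![p, 0, 0] (by simp [Fin.sum_univ_three, h])
  simpa using congrFun this 0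

end Eval

end OddCover

end Polynomials

theorem neZero_two_of_algebra (K F : Type*) [Field K] [Field F] [Algebra K F] [NeZero (2 : K)] :
    NeZero (2 : F) := ⟨by
  have := (map_ne_zero (algebraMap K F)).mpr (two_ne_zero (α := K))
  rwa [map_ofNat] at this⟩

/-! ### Values of the coordinate functions, in particular at infinity -/

section CoordinateValues

variable {K : Type u} [Field K] (E : WeierstrassCurve K) {F : Type*} [Field F] [Algebra K F]

theorem genericCoords_two : genericCoords E 2 = 1 := rfl

theorem genericCoords_zero_ne_zero : genericCoords E 0 ≠ 0 := by
  intro h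
  exact Polynomial.X_ne_zero (aeval_genericCoords_zero_eq_zero E (p := Polynomial.X) (by simpa))

theorem centredY_genericCoords_ne_zero [NeZero (2 : K)] :
    centredY (E.baseChange E.toAffine.FunctionField) (genericCoords E 0) (genericCoords E 1) ≠
      0 := by
  have : NeZero (2 : E.toAffine.FunctionField) := neZero_two_of_algebra K _
  have h := (equation_iff_centredY _ _ _).mp (equation_genericCoords E)
  rw [← aeval_cubicPoly] at h
  intro h0
  rw [h0, zero_pow two_ne_zero] at h
  have := aeval_genericCoords_zero_eq_zero E h.symm
  have h3 := natDegree_cubicPoly E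
  simp [this] at h3

variable {E}

theorem hasValueAt_genericCoords_some {x y : F} (h : (E.baseChange F).toAffine.Nonsingular x y) :
    HasValueAt E (genericCoords E 0) (.some x y h) x ∧
      HasValueAt E (genericCoords E 1) (.some x y h) y := by
  refine ⟨⟨1, .X 0, .X 2, MvPolynomial.isHomogeneous_X .., MvPolynomial.isHomogeneous_X .., ?_⟩,
    ⟨1, .X 1, .X 2, MvPolynomial.isHomogeneous_X .., MvPolynomial.isHomogeneous_X .., ?_⟩⟩ <;>
  simp [genericCoords_two, projCoords]

/-- η is represented by a linear form B with B(0, 1, 0) = 1, so the two functions are X/B and Z/B.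
-/
theorem hasValueAt_div_centredY_zero [NeZero (2 : K)] :
    HasValueAt E (genericCoords E 0 / centredY (E.baseChange E.toAffine.FunctionField)
      (genericCoords E 0) (genericCoords E 1)) (0 : (E.baseChange F).toAffine.Point) 0 ∧
    HasValueAt E (centredY (E.baseChange E.toAffine.FunctionField)
      (genericCoords E 0) (genericCoords E 1))⁻¹ (0 : (E.baseChange F).toAffine.Point) 0 := by
  let B : MvPolynomial (Fin 3) K := .X 1 + .C (E.a₁ / 2) * .X 0 + .C (E.a₃ / 2) * .X 2
  have hB : B.IsHomogeneous 1 := by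
    refine ((MvPolynomial.isHomogeneous_X ..).add ?_).add ?_
    · exact (MvPolynomial.isHomogeneous_X ..).C_mul _
    · exact (MvPolynomial.isHomogeneous_X ..).C_mul _
  have hBg : MvPolynomial.aeval (genericCoords E) B =
      centredY (E.baseChange E.toAffine.FunctionField) (genericCoords E 0) (genericCoords E 1) := by
    simp [B, centredY, WeierstrassCurve.baseChange, genericCoords_two, map_ofNat]
    ring
  have hBQ : MvPolynomial.aeval (projCoords (0 : (E.baseChange F).toAffine.Point)) B = 1 := by
    simp [B, projCoords]
  have h0 := centredY_genericCoords_ne_zero E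
  rw [← hBg] at h0 ⊢
  refine ⟨⟨1, .X 0, B, MvPolynomial.isHomogeneous_X .., hB, h0, by simp, by simp [hBQ], ?_⟩,
    ⟨1, .X 2, B, MvPolynomial.isHomogeneous_X .., hB, h0, by simp [genericCoords_two],
      by simp [hBQ], ?_⟩⟩ <;>
  simp [projCoords]

/-- Neither 1/x = Z/X nor its inverse has a usable denominator at [0 : 1 : 0]. Dividing the curve
equation by xη² gives x⁻¹(1 − (b₆/4)η⁻²) as a polynomial in x/η and 1/η without constant term, and
the factor in brackets has value 1. -/
theorem hasValueAt_inv_zero [NeZero (2 : K)] :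
    HasValueAt E (genericCoords E 0)⁻¹ (0 : (E.baseChange F).toAffine.Point) 0 := by
  have : NeZero (2 : E.toAffine.FunctionField) := neZero_two_of_algebra K _
  obtain ⟨ht, hw⟩ := hasValueAt_div_centredY_zero (E := E) (F := F)
  have hx0 := genericCoords_zero_ne_zero E
  have hy0 := centredY_genericCoords_ne_zero E
  have heq := (equation_iff_centredY _ _ _).mp (equation_genericCoords E)
  set x := genericCoords E 0
  set y := centredY (E.baseChange E.toAffine.FunctionField) x (genericCoords E 1)
  have h2 : (2 : E.toAffine.FunctionField) ≠ 0 := two_ne_zero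
  have h4 : (4 : E.toAffine.FunctionField) ≠ 0 := by
    rw [show (4 : E.toAffine.FunctionField) = 2 * 2 by norm_num]; exact mul_ne_zero h2 h2
  have hnum := ((ht.pow 2).add ((ht.mul hw).const_mul (E.b₂ / 4))).add
    ((hw.pow 2).const_mul (E.b₄ / 2))
  have hden := (hasValueAt_algebraMap 0 (1 : K)).sub ((hw.pow 2).const_mul (E.b₆ / 4))
  have hrel : x⁻¹ * (algebraMap K _ 1 - algebraMap K E.toAffine.FunctionField (E.b₆ / 4) * y⁻¹ ^ 2) =
      (x / y) ^ 2 + algebraMap K E.toAffine.FunctionField (E.b₂ / 4) * (x / y * y⁻¹) +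
        algebraMap K E.toAffine.FunctionField (E.b₄ / 2) * y⁻¹ ^ 2 := by
    simp only [cubic, WeierstrassCurve.baseChange, map_b₂, map_b₄, map_b₆] at heq
    simp only [map_div₀, map_ofNat, map_one]
    apply mul_left_cancel₀ (mul_ne_zero hx0 (pow_ne_zero 2 hy0))
    have hl : ∀ b : E.toAffine.FunctionField,
        x * y ^ 2 * (x⁻¹ * (1 - b / 4 * y⁻¹ ^ 2)) = y ^ 2 - b / 4 := fun b => by field_simp
    have hr : ∀ b b' : E.toAffine.FunctionField,
        x * y ^ 2 * ((x / y) ^ 2 + b / 4 * (x / y * y⁻¹) + b' / 2 * y⁻¹ ^ 2) =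
          x ^ 3 + b / 4 * x ^ 2 + b' / 2 * x := fun b b' => by field_simp
    rw [hl, hr, heq, add_sub_cancel_right]
  have hden0 : algebraMap K E.toAffine.FunctionField 1 -
      algebraMap K E.toAffine.FunctionField (E.b₆ / 4) * y⁻¹ ^ 2 ≠ 0 := by
    intro h
    have : (1 : E.toAffine.FunctionField) -
        algebraMap K E.toAffine.FunctionField (E.b₆ / 4) * y⁻¹ ^ 2 = 0 := by
      simpa using h
    have h1 : y ^ 2 = algebraMap K E.toAffine.FunctionField (E.b₆ / 4) := by
      field_simp at this
      linear_combination this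
    rw [heq, ← aeval_cubicPoly, ← sub_eq_zero, ← Polynomial.aeval_C x (E.b₆ / 4), ← map_sub] at h1
    have h2 := aeval_genericCoords_zero_eq_zero E h1
    have h3 := natDegree_cubicPoly E
    rw [sub_eq_zero.mp h2] at h3
    simp at h3
  rw [eq_div_of_mul_eq hden0 hrel]
  have := hnum.div hden hden0 (by simp)
  simpa using this

/-- The function is the reversed polynomial evaluated at 1/x, which has value 0 at infinity. -/
theorem hasValueAt_aeval_div_pow_zero [NeZero (2 : K)] (p : Polynomial K) :
    HasValueAt E (Polynomial.aeval (genericCoords E 0) p / genericCoords E 0 ^ p.natDegree)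
      (0 : (E.baseChange F).toAffine.Point) (algebraMap K F p.leadingCoeff) := by
  have := (hasValueAt_inv_zero (E := E) (F := F)).aeval p.reverse
  have hx0 := genericCoords_zero_ne_zero E
  have : Invertible (genericCoords E 0) := invertibleOfNonzero hx0
  have h := Polynomial.eval₂_reverse_mul_pow (algebraMap K E.toAffine.FunctionField)
    (genericCoords E 0) p
  rw [invOf_eq_inv] at h
  rw [Polynomial.aeval_def, ← h, mul_div_cancel_right₀ _ (pow_ne_zero _ hx0), ← Polynomial.aeval_def]
  convert (hasValueAt_inv_zero (E := E) (F := F)).aeval p.reverse using 1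
  rw [← Polynomial.coeff_zero_reverse, Polynomial.aeval_def, Polynomial.eval₂_at_zero]

end CoordinateValues

/-! ### The isogeny attached to an odd cover -/

namespace OddCover

variable {K : Type u} [Field K] {E' E : WeierstrassCurve K} (c : OddCover E' E)

open Classical in
/-- The map on points given by `(x, η) ↦ (num / den², η fac / den³)`. -/
noncomputable def pointMap [NeZero (2 : K)] [E.IsElliptic] (F : Type*) [Field F] [Algebra K F] :
    (E'.baseChange F).toAffine.Point → (E.baseChange F).toAffine.Point
  | .zero => 0
  | .some x y h =>
    if hx : Polynomial.aeval x c.den = 0 then 0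
    else .some (c.mapX x) (c.mapY x y) <| by
      have : NeZero (2 : F) := neZero_two_of_algebra K _
      have : (E.baseChange F).IsElliptic := inferInstanceAs (E.map _).IsElliptic
      exact Affine.equation_iff_nonsingular.mp (c.equation_map h.1 hx)

theorem exists_isogeny [NeZero (2 : K)] [E.IsElliptic] :
    ∃ φ : Isogeny E' E, φ.toFun = c.pointMap (AlgebraicClosure K) ∧
      φ.pullback (genericCoords E 0) = c.mapX (genericCoords E' 0) ∧
      φ.pullback (genericCoords E 1) = c.mapY (genericCoords E' 0) (genericCoords E' 1) := by
  have : NeZero (2 : E'.toAffine.FunctionField) := neZero_two_of_algebra K _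
  have : NeZero (2 : AlgebraicClosure K) := neZero_two_of_algebra K _
  have hx := fun p => aeval_genericCoords_zero_eq_zero E' (p := p)
  have hd : Polynomial.aeval (genericCoords E' 0) c.den ≠ 0 := fun h => c.den_ne_zero (hx _ h)
  obtain ⟨φ, hφ0, hφ1⟩ := exists_pullback (c.equation_map (equation_genericCoords E') hd)
    (c.eq_zero_of_aeval_mapX hx)
  refine ⟨⟨c.pointMap _, φ, ?_, rfl⟩, rfl, hφ0, hφ1⟩
  have hφ2 : φ (genericCoords E 2) = 1 := by rw [genericCoords_two, map_one]
  have hY : c.mapY (genericCoords E' 0) (genericCoords E' 1) =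
      centredY (E'.baseChange E'.toAffine.FunctionField) (genericCoords E' 0) (genericCoords E' 1) *
        Polynomial.aeval (genericCoords E' 0) c.fac / Polynomial.aeval (genericCoords E' 0) c.den ^ 3 -
      (algebraMap K _ (E.a₁ / 2) * c.mapX (genericCoords E' 0) + algebraMap K _ (E.a₃ / 2)) := by
    rw [mapY, map_div₀, map_div₀, map_ofNat]
    simp only [WeierstrassCurve.baseChange, map_a₁, map_a₃]
    ring
  have hX : c.mapX (genericCoords E' 0) = Polynomial.aeval (genericCoords E' 0) c.num /
    Polynomial.aeval (genericCoords E' 0) c.den ^ 2 := rfl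
  rintro (_ | ⟨q₁, q₂, hq⟩) h v hv
  · change HasValueAt E' (φ h) 0 v
    have hx0 := genericCoords_zero_ne_zero E'
    have hy0 := centredY_genericCoords_ne_zero E'
    obtain ⟨ht, hw⟩ := hasValueAt_div_centredY_zero (E := E') (F := AlgebraicClosure K)
    have hN := hasValueAt_aeval_div_pow_zero (E := E') (F := AlgebraicClosure K) c.num
    have hD := hasValueAt_aeval_div_pow_zero (E := E') (F := AlgebraicClosure K) c.den
    have hC := hasValueAt_aeval_div_pow_zero (E := E') (F := AlgebraicClosure K) c.fac
    rw [c.natDegree_num] at hN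
    rw [c.degree_fac.2] at hC
    have hlD : algebraMap K (AlgebraicClosure K) c.den.leadingCoeff ≠ 0 := by
      simpa using c.den_ne_zero
    have hlC : algebraMap K (AlgebraicClosure K) c.fac.leadingCoeff ≠ 0 := by
      simpa using c.degree_fac.1
    have hD0 := div_ne_zero hd (pow_ne_zero c.den.natDegree hx0)
    have hs0 := (ht.mul hN).div (hD.pow 2) (pow_ne_zero 2 hD0) (pow_ne_zero 2 hlD)
    have hs1 := (hC.div (hD.pow 3) (pow_ne_zero 3 hD0) (pow_ne_zero 3 hlD)).sub
      ((hs0.const_mul (E.a₁ / 2)).add (hw.const_mul (E.a₃ / 2)))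
    -- At infinity the image of the generic point is scaled by 1/η; it then specialises to [0 :
    -- lc(fac)/lc(den)³ : 0].
    refine HasValueAt.pullback φ (inv_ne_zero hy0)
      (div_ne_zero hlC (pow_ne_zero 3 hlD)) (fun i => ?_) hv
    fin_cases i
    · convert hs0 using 1
      · simp only [Fin.zero_eta, hφ0, hX]
        field_simp
        try ring
      · change _ * (![0, 1, 0] : Fin 3 → AlgebraicClosure K) _ = _
        simp
    · convert hs1 using 1
      · simp only [Fin.mk_one, hφ1, hY, hX]
        field_simp
        try ring
      · change _ * (![0, 1, 0] : Fin 3 → AlgebraicClosure K) _ = _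
        simp
    · convert hw using 1
      · simp only [Fin.reduceFinMk, hφ2, mul_one]
      · change _ * (![0, 1, 0] : Fin 3 → AlgebraicClosure K) _ = _
        simp
  · obtain ⟨h0, h1⟩ := hasValueAt_genericCoords_some hq
    have hη : HasValueAt E' (centredY (E'.baseChange E'.toAffine.FunctionField)
        (genericCoords E' 0) (genericCoords E' 1)) (.some q₁ q₂ hq)
        (centredY (E'.baseChange (AlgebraicClosure K)) q₁ q₂) := by
      convert h1.add ((h0.const_mul (E'.a₁ / 2)).add (hasValueAt_algebraMap _ (E'.a₃ / 2))) using 1 <;>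
      · simp only [centredY, map_div₀, map_ofNat, WeierstrassCurve.baseChange, map_a₁, map_a₃]
        ring
    have hN := h0.aeval c.num
    have hD := h0.aeval c.den
    have hC := h0.aeval c.fac
    have hs0 := hN.mul hD
    have hs2 := hD.pow 3
    -- At affine points the scaling is by den³, giving the polynomial coordinates [num·den : η·fac −
    -- (a₁·num·den + a₃·den³)/2 : den³]. At a zero of den only the middle one survives.
    have hs1 := (hη.mul hC).sub ((hs0.const_mul (E.a₁ / 2)).add (hs2.const_mul (E.a₃ / 2)))
    by_cases hq0 : Polynomial.aeval q₁ c.den = 0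
    · refine HasValueAt.pullback φ (pow_ne_zero 3 hd) (c.fac_ne_zero hq.1 hq0) (fun i => ?_) hv
      fin_cases i
      · convert hs0 using 1
        · simp only [Fin.zero_eta, hφ0, hX]
          field_simp
        · simp [pointMap, Affine.Point.zero_def, projCoords, hq0]
      · convert hs1 using 1
        · simp only [Fin.mk_one, hφ1, hY, hX]
          field_simp
          try ring
        · simp [pointMap, Affine.Point.zero_def, projCoords, hq0]
      · convert hs2 using 1
        · simp only [Fin.reduceFinMk, hφ2, mul_one]
        · simp [pointMap, Affine.Point.zero_def, projCoords, hq0]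
    · refine HasValueAt.pullback φ (pow_ne_zero 3 hd) (pow_ne_zero 3 hq0) (fun i => ?_) hv
      fin_cases i
      · convert hs0 using 1
        · simp only [Fin.zero_eta, hφ0, hX]
          field_simp
        · simp [pointMap, projCoords, hq0, mapX]
          field_simp
      · convert hs1 using 1
        · simp only [Fin.mk_one, hφ1, hY, hX]
          field_simp
          try ring
        · simp [pointMap, projCoords, hq0, mapX, mapY, map_ofNat, WeierstrassCurve.baseChange]
          field_simp
          try ring
      · convert hs2 using 1
        · simp only [Fin.reduceFinMk, hφ2, mul_one]
        · simp [pointMap, projCoords, hq0]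

end OddCover

/-! ### Degree of an odd cover, and magnification -/

namespace OddCover

open Polynomial

variable {K : Type u} [Field K] {E' E : WeierstrassCurve K} (c : OddCover E' E)

theorem _root_.EllIsog.exists_eq_div_genericCoords (E : WeierstrassCurve K)
    (z : E.toAffine.FunctionField) : ∃ p q r s : K[X],
      z = (aeval (genericCoords E 0) p + aeval (genericCoords E 0) q * genericCoords E 1) /
        (aeval (genericCoords E 0) r + aeval (genericCoords E 0) s * genericCoords E 1) := by
  have key (n : E.toAffine.CoordinateRing) : ∃ p q : K[X],
      algebraMap _ E.toAffine.FunctionField n =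
        aeval (genericCoords E 0) p + aeval (genericCoords E 0) q * genericCoords E 1 := by
    obtain ⟨p, q, rfl⟩ := Affine.CoordinateRing.exists_smul_basis_eq n
    refine ⟨p, q, ?_⟩
    rw [aeval_genericCoords_zero, aeval_genericCoords_zero, map_add, Algebra.smul_def,
      Algebra.smul_def, mul_one, map_mul]
    rfl
  obtain ⟨n, m, -, rfl⟩ := IsFractionRing.div_surjective (A := E.toAffine.CoordinateRing) z
  obtain ⟨p, q, hn⟩ := key n
  obtain ⟨r, s, hm⟩ := key m
  exact ⟨p, q, r, s, by rw [hn, hm]⟩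

/-- `Module.finrank` is 0 for infinite extensions, so a lower bound on the degree needs finiteness
first. Here x is a root of num − `mapX x`·den², nonzero since deg num > 2 deg den, and y is integral
over x. -/
theorem finiteDimensional_of_mapX_mem [NeZero (2 : K)]
    (S : IntermediateField K E'.toAffine.FunctionField)
    (hS : c.mapX (genericCoords E' 0) ∈ S) : FiniteDimensional S E'.toAffine.FunctionField := by
  have : NeZero (2 : E'.toAffine.FunctionField) := neZero_two_of_algebra K _
  have hx0 := fun p => aeval_genericCoords_zero_eq_zero E' (p := p)
  have hd : aeval (genericCoords E' 0) c.den ≠ 0 := fun h => c.den_ne_zero (hx0 _ h)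
  have heq := (equation_iff_centredY _ _ _).mp (equation_genericCoords E')
  set x := genericCoords E' 0
  set y := genericCoords E' 1
  have hconst : ∀ a : K, IsIntegral S (algebraMap K E'.toAffine.FunctionField a) :=
    fun a => isIntegral_algebraMap.tower_top (A := S)
  have hx : IsIntegral S x := by
    rw [← isAlgebraic_iff_isIntegral]
    let p : S[X] := c.num.map (algebraMap K S) - C ⟨_, hS⟩ * c.den.map (algebraMap K S) ^ 2
    refine ⟨p, ?_, ?_⟩
    · intro hp
      have h1 : (c.num.map (algebraMap K S)).natDegree =
          (C (⟨_, hS⟩ : S) * c.den.map (algebraMap K S) ^ 2).natDegree := by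
        rw [sub_eq_zero.mp hp]
      have h2 := natDegree_C_mul_le (⟨_, hS⟩ : S) (c.den.map (algebraMap K S) ^ 2)
      rw [← h1, natDegree_pow, natDegree_map, natDegree_map, c.natDegree_num] at h2
      omega
    · have : algebraMap S E'.toAffine.FunctionField ⟨_, hS⟩ =
        aeval x c.num / aeval x c.den ^ 2 := rfl
      simp only [p, map_sub, map_mul, map_pow, aeval_map_algebraMap, aeval_C, this]
      field_simp
      ring
  have hy : IsIntegral S y := by
    have hη : IsIntegral S (centredY (E'.baseChange E'.toAffine.FunctionField) x y) := by
      refine IsIntegral.of_pow two_pos ?_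
      rw [heq, ← aeval_cubicPoly]
      simp only [cubicPoly, map_add, map_mul, map_pow, aeval_X, aeval_C]
      exact (((hx.pow 3).add ((hconst _).mul (hx.pow 2))).add ((hconst _).mul hx)).add (hconst _)
    have hyη : y = centredY (E'.baseChange E'.toAffine.FunctionField) x y -
        (algebraMap K _ (E'.a₁ / 2) * x + algebraMap K _ (E'.a₃ / 2)) := by
      simp only [centredY, map_div₀, map_ofNat, WeierstrassCurve.baseChange, map_a₁, map_a₃]
      ring
    rw [hyη]
    exact hη.sub (((hconst _).mul hx).add (hconst _))
  have hfin : FiniteDimensional S (IntermediateField.adjoin S {x, y}) := by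
    apply IntermediateField.finiteDimensional_adjoin
    rintro z (rfl | rfl)
    exacts [hx, hy]
  have htop : IntermediateField.adjoin S {x, y} = ⊤ := by
    rw [eq_top_iff]
    rintro z -
    have hxm : x ∈ IntermediateField.adjoin S {x, y} :=
      IntermediateField.subset_adjoin S _ (by simp)
    have hym : y ∈ IntermediateField.adjoin S {x, y} :=
      IntermediateField.subset_adjoin S _ (by simp)
    have hp (p : K[X]) : aeval x p ∈ IntermediateField.adjoin S {x, y} := by
      rw [← aeval_map_algebraMap S]
      generalize p.map (algebraMap K S) = q
      have h : aeval x q = algebraMap (IntermediateField.adjoin S {x, y}) _ (aeval ⟨x, hxm⟩ q) :=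
        aeval_algebraMap_apply _ (⟨x, hxm⟩ : IntermediateField.adjoin S {x, y}) q
      rw [h]
      exact (aeval (⟨x, hxm⟩ : IntermediateField.adjoin S {x, y}) q).2
    obtain ⟨p, q, r, s, rfl⟩ := exists_eq_div_genericCoords E' z
    exact div_mem (add_mem (hp p) (mul_mem (hp q) hym)) (add_mem (hp r) (mul_mem (hp s) hym))
  rw [htop] at hfin
  exact Module.Finite.equiv (IntermediateField.topEquiv (F := S)).toLinearEquiv

theorem _root_.EllIsog.finrank_pos_of_intermediateField {L : Type*} [Field L] [Algebra K L]
    (S : IntermediateField K L) [FiniteDimensional S L] : 0 < Module.finrank S L :=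
  Module.finrank_pos

theorem _root_.EllIsog.mem_of_finrank_eq_one {L : Type*} [Field L] [Algebra K L]
    (S : IntermediateField K L) (h : Module.finrank S L = 1) (z : L) : z ∈ S := by
  have hz : z ∈ (⊥ : Subalgebra S L) := by
    rw [Subalgebra.bot_eq_top_of_finrank_eq_one h]; trivial
  obtain ⟨w, rfl⟩ := Algebra.mem_bot.mp hz
  exact w.2

/-- In degree 1 the coordinate x' of E' would be the pull-back of some h. Pulling back a quadratic
relation of h over K[x] would give one of x' over K[`mapX x'`], against `eq_zero_of_relation`. -/
theorem one_lt_degree [NeZero (2 : K)] (φ : Isogeny E' E)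
    (hφ : φ.pullback (genericCoords E 0) = c.mapX (genericCoords E' 0)) : 1 < φ.degree := by
  have hfin := c.finiteDimensional_of_mapX_mem φ.pullback.fieldRange ⟨_, hφ⟩
  have hpos : 0 < φ.degree := finrank_pos_of_intermediateField _
  refine lt_of_le_of_ne hpos fun h => ?_
  obtain ⟨h0, hh0⟩ : ∃ h0, φ.pullback h0 = genericCoords E' 0 := by
    obtain ⟨z, hz⟩ := mem_of_finrank_eq_one φ.pullback.fieldRange h.symm (genericCoords E' 0)
    exact ⟨z, hz⟩
  obtain ⟨p, hp, hrel⟩ := exists_quadratic_relation E h0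
  refine hp (c.eq_zero_of_relation (fun p => aeval_genericCoords_zero_eq_zero E') p ?_)
  have := congrArg φ.pullback hrel
  simpa only [map_sum, map_mul, map_pow, map_zero, ← aeval_algHom_apply, hφ, hh0] using this

theorem pointMap_of_eq_zero [NeZero (2 : K)] [E.IsElliptic] {F : Type*} [Field F] [Algebra K F]
    {x y : F} (h : (E'.baseChange F).toAffine.Nonsingular x y) (hx : aeval x c.den = 0) :
    c.pointMap F (.some x y h) = 0 := dif_pos hx

theorem exists_pointMap_of_ne_zero [NeZero (2 : K)] [E.IsElliptic] {F : Type*} [Field F]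
    [Algebra K F] {x y : F} (h : (E'.baseChange F).toAffine.Nonsingular x y)
    (hx : aeval x c.den ≠ 0) :
    ∃ h', c.pointMap F (.some x y h) = .some (c.mapX x) (c.mapY x y) h' :=
  ⟨_, dif_neg hx⟩

theorem _root_.EllIsog.some_congr {F : Type*} [Field F] {W : Affine F} {x y x' y' : F}
    {h : W.Nonsingular x y} {h' : W.Nonsingular x' y'} (hx : x = x') (hy : y = y') :
    Affine.Point.some x y h = Affine.Point.some x' y' h' := by
  subst hx hy; rfl

theorem pointMap_baseChange [NeZero (2 : K)] [E.IsElliptic] [DecidableEq K] (F : Type*) [Field F]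
    [DecidableEq F] [Algebra K F] (Q : (E'.baseChange K).toAffine.Point) :
    c.pointMap F (Affine.Point.baseChange K F Q) = Affine.Point.baseChange K F (c.pointMap K Q) := by
  have hX (x : K) : c.mapX (algebraMap K F x) = algebraMap K _ (c.mapX x) := by
    simp [mapX, aeval_algebraMap_apply]
  have hY (x y : K) : c.mapY (algebraMap K F x) (algebraMap K _ y) =
      algebraMap K _ (c.mapY x y) := by
    simp [mapY, hX, centredY, aeval_algebraMap_apply, WeierstrassCurve.baseChange, map_ofNat]
  rcases Q with _ | ⟨x, y, h⟩
  · rfl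
  · have h' : (E'.baseChange F).toAffine.Nonsingular (algebraMap K _ x)
        (algebraMap K _ y) := (Affine.baseChange_nonsingular E' (f := Algebra.ofId K _)
      (FaithfulSMul.algebraMap_injective K F) x y).mpr h
    by_cases hx : aeval x c.den = 0
    · rw [c.pointMap_of_eq_zero h hx]
      refine c.pointMap_of_eq_zero h' ?_
      rw [aeval_algebraMap_apply, hx, map_zero]
    · obtain ⟨h₁, e₁⟩ := c.exists_pointMap_of_ne_zero h hx
      obtain ⟨h₂, e₂⟩ := c.exists_pointMap_of_ne_zero h' (by
        rw [aeval_algebraMap_apply]; simpa using hx)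
      rw [e₁]
      exact e₂.trans (some_congr (hX x) (hY x y))

/-- A point in the image of the rational points under an odd cover is magnified. -/
theorem isKMagnified [NeZero (2 : K)] [E.IsElliptic] (hE' : E'.IsElliptic)
    (Q : (E'.baseChange K).toAffine.Point) : IsKMagnified E (c.pointMap K Q) := by
  classical
  obtain ⟨φ, hφ, h0, -⟩ := c.exists_isogeny
  refine ⟨E', hE', φ, Q, c.one_lt_degree φ h0, ?_⟩
  rw [hφ]
  convert c.pointMap_baseChange (AlgebraicClosure K) Q

end OddCover

/-! ### Doubling and tripling formulas in the coordinates x, η -/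

section GroupLaw

variable {F : Type*} [Field F] {W : WeierstrassCurve F}

/-- The derivative of the cubic `g`. -/
def cubicDeriv (W : WeierstrassCurve F) (x : F) : F := 3 * x ^ 2 + W.b₂ / 2 * x + W.b₄ / 2

/-- The `y`-coordinate of the point with given `x` and `η = y + (a₁ x + a₃) / 2`. -/
def uncentredY (W : WeierstrassCurve F) (x η : F) : F := η - (W.a₁ * x + W.a₃) / 2

theorem centredY_uncentredY (x η : F) : centredY W x (uncentredY W x η) = η :=
  sub_add_cancel _ _

theorem uncentredY_centredY (x y : F) : uncentredY W x (centredY W x y) = y :=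
  add_sub_cancel_right _ _

theorem exists_some_eq {x y x' y' : F} {h : W.toAffine.Nonsingular x y} (hx : x = x')
    (hy : y = y') : ∃ h', Affine.Point.some x y h = Affine.Point.some (W' := W) x' y' h' := by
  subst hx hy; exact ⟨h, rfl⟩

variable [NeZero (2 : F)]

theorem four_ne_zero_of_neZero_two : (4 : F) ≠ 0 := by
  rw [show (4 : F) = 2 * 2 by norm_num]; exact mul_ne_zero two_ne_zero two_ne_zero

theorem centredY_negY (x y : F) : centredY W x (W.toAffine.negY x y) = -centredY W x y := by
  have h2 : (2 : F) ≠ 0 := two_ne_zero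
  simp only [centredY, Affine.negY]
  field_simp
  ring

variable [DecidableEq F]

/-- In the coordinates (x, η) a line of slope ℓ acquires slope m = ℓ + a₁/2, and the third
intersection follows from the sum of the roots of g(x) minus the square of the line. -/
theorem add_eq_of_slope {x₁ y₁ x₂ y₂ : F} {h₁ : W.toAffine.Nonsingular x₁ y₁}
    {h₂ : W.toAffine.Nonsingular x₂ y₂} (hxy : ¬(x₁ = x₂ ∧ y₁ = W.toAffine.negY x₂ y₂)) {m X : F}
    (hm : W.toAffine.slope x₁ x₂ y₁ y₂ + W.a₁ / 2 = m) (hX : m ^ 2 - W.b₂ / 4 - x₁ - x₂ = X) :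
    ∃ h, Affine.Point.some x₁ y₁ h₁ + Affine.Point.some x₂ y₂ h₂ =
      Affine.Point.some X (uncentredY W X (-(centredY W x₁ y₁ + m * (X - x₁)))) h := by
  have h2 : (2 : F) ≠ 0 := two_ne_zero
  have h4 : (4 : F) ≠ 0 := four_ne_zero_of_neZero_two
  rw [Affine.Point.add_some hxy]
  have e₁ : W.toAffine.addX x₁ x₂ (W.toAffine.slope x₁ x₂ y₁ y₂) = X := by
    rw [← hX, ← hm, Affine.addX, b₂]
    field_simp
    ring
  have e₂ : W.toAffine.addY x₁ x₂ y₁ (W.toAffine.slope x₁ x₂ y₁ y₂) =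
      uncentredY W X (-(centredY W x₁ y₁ + m * (X - x₁))) := by
    rw [Affine.addY, Affine.negAddY, e₁, ← hm, Affine.negY, uncentredY, centredY]
    field_simp
    ring
  exact exists_some_eq e₁ e₂

theorem add_eq_of_ne {x₁ y₁ x₂ y₂ : F} (h₁ : W.toAffine.Nonsingular x₁ y₁)
    (h₂ : W.toAffine.Nonsingular x₂ y₂) (hx : x₁ ≠ x₂) {m X : F}
    (hm : (centredY W x₁ y₁ - centredY W x₂ y₂) / (x₁ - x₂) = m)
    (hX : m ^ 2 - W.b₂ / 4 - x₁ - x₂ = X) :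
    ∃ h, Affine.Point.some x₁ y₁ h₁ + Affine.Point.some x₂ y₂ h₂ =
      Affine.Point.some X (uncentredY W X (-(centredY W x₁ y₁ + m * (X - x₁)))) h := by
  have h2 : (2 : F) ≠ 0 := two_ne_zero
  have hs := sub_ne_zero.mpr hx
  refine add_eq_of_slope (fun h => hx h.1) ?_ hX
  rw [Affine.slope_of_X_ne hx, ← hm, centredY, centredY]
  field_simp
  ring

theorem add_self_eq {x y : F} (h₁ : W.toAffine.Nonsingular x y) (hη : centredY W x y ≠ 0) {m X : F}
    (hm : cubicDeriv W x / (2 * centredY W x y) = m) (hX : m ^ 2 - W.b₂ / 4 - x - x = X) :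
    ∃ h, Affine.Point.some x y h₁ + Affine.Point.some x y h₁ =
      Affine.Point.some X (uncentredY W X (-(centredY W x y + m * (X - x)))) h := by
  have h2 : (2 : F) ≠ 0 := two_ne_zero
  have hy : y - W.toAffine.negY x y = 2 * centredY W x y := by
    rw [Affine.negY, centredY]; field_simp; ring
  have hne : y ≠ W.toAffine.negY x y := by
    rw [← sub_ne_zero, hy]; exact mul_ne_zero h2 hη
  refine add_eq_of_slope (fun h => hne h.2) ?_ hX
  rw [Affine.slope_of_Y_ne rfl hne, hy, ← hm, cubicDeriv, b₂, b₄]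
  field_simp
  rw [centredY]
  field_simp
  ring

theorem two_nsmul_eq_zero_of_centredY {x y : F} (h : W.toAffine.Nonsingular x y)
    (hη : centredY W x y = 0) : 2 • Affine.Point.some x y h = 0 := by
  have h2 : (2 : F) ≠ 0 := two_ne_zero
  rw [two_nsmul]
  refine Affine.Point.add_self_of_Y_eq ?_
  rw [centredY] at hη
  rw [Affine.negY]
  field_simp at hη
  linear_combination hη

/-- The `3`-division polynomial `ψ₃ = 2 g g'' - g'²`. -/
def psiThree (W : WeierstrassCurve F) (x : F) : F :=
  (12 * x + W.b₂) * cubic W x - cubicDeriv W x ^ 2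

/-- The numerator of the `x`-coordinate of `3 P`. -/
def tripleNum (W : WeierstrassCurve F) (x : F) : F :=
  x * psiThree W x ^ 2 + 8 * cubic W x * (8 * cubic W x ^ 2 - cubicDeriv W x * psiThree W x)

/-- The numerator of `η(3 P) / η(P)`. -/
def tripleFac (W : WeierstrassCurve F) (x : F) : F :=
  -psiThree W x ^ 3 - 4 * (16 * cubic W x ^ 2 - cubicDeriv W x * psiThree W x) *
    (8 * cubic W x ^ 2 - cubicDeriv W x * psiThree W x)

theorem exists_two_nsmul_eq {x y : F} (h : W.toAffine.Nonsingular x y) (hη : centredY W x y ≠ 0) :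
    ∃ h', 2 • Affine.Point.some x y h = Affine.Point.some (x - psiThree W x / (4 * cubic W x))
      (uncentredY W (x - psiThree W x / (4 * cubic W x)) (-centredY W x y +
        cubicDeriv W x * psiThree W x / (8 * cubic W x * centredY W x y))) h' := by
  have h2 : (2 : F) ≠ 0 := two_ne_zero
  have h4 : (4 : F) ≠ 0 := four_ne_zero_of_neZero_two
  have h8 : (8 : F) ≠ 0 := by
    rw [show (8 : F) = 2 * 4 by norm_num]; exact mul_ne_zero h2 h4
  have heq := (equation_iff_centredY W x y).mp h.1
  have hψ : psiThree W x = (12 * x + W.b₂) * cubic W x - cubicDeriv W x ^ 2 := rfl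
  obtain ⟨h', e⟩ := add_self_eq h hη rfl rfl
  rw [two_nsmul, e]
  set η := centredY W x y
  have hX : (cubicDeriv W x / (2 * η)) ^ 2 - W.b₂ / 4 - x - x =
      x - psiThree W x / (4 * cubic W x) := by
    rw [hψ, ← heq]
    field_simp
    ring
  have hY : -(η + cubicDeriv W x / (2 * η) * (x - psiThree W x / (4 * cubic W x) - x)) =
      -η + cubicDeriv W x * psiThree W x / (8 * cubic W x * η) := by
    rw [← heq]
    field_simp
    ring
  exact exists_some_eq hX (by rw [hX, hY])

/-- If ψ₃ vanishes, the duplication formula leaves x unchanged and negates η, so 2P = −P. -/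
theorem three_nsmul_eq_zero {x y : F} (h : W.toAffine.Nonsingular x y) (hη : centredY W x y ≠ 0)
    (hψ : psiThree W x = 0) : 3 • Affine.Point.some x y h = 0 := by
  obtain ⟨h', e⟩ := exists_two_nsmul_eq h hη
  rw [succ_nsmul, e, ← eq_neg_iff_add_eq_zero, Affine.Point.neg_some]
  refine some_congr (by simp [hψ]) ?_
  rw [← uncentredY_centredY (W := W) x (W.toAffine.negY x y), centredY_negY]
  simp [hψ]

/-- Chord addition of P and 2P, whose x-coordinates differ by ψ₃/(4g) ≠ 0. -/
theorem exists_three_nsmul_eq {x y : F} (h : W.toAffine.Nonsingular x y) (hη : centredY W x y ≠ 0)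
    (hψ : psiThree W x ≠ 0) :
    ∃ h', 3 • Affine.Point.some x y h = Affine.Point.some (tripleNum W x / psiThree W x ^ 2)
      (uncentredY W (tripleNum W x / psiThree W x ^ 2)
        (centredY W x y * tripleFac W x / psiThree W x ^ 3)) h' := by
  have h2 : (2 : F) ≠ 0 := two_ne_zero
  have h4 : (4 : F) ≠ 0 := four_ne_zero_of_neZero_two
  have h8 : (8 : F) ≠ 0 := by
    rw [show (8 : F) = 2 * 4 by norm_num]; exact mul_ne_zero h2 h4
  have heq := (equation_iff_centredY W x y).mp h.1
  have hdef : (12 * x + W.b₂) * cubic W x = psiThree W x + cubicDeriv W x ^ 2 := by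
    rw [psiThree]; ring
  have hg : cubic W x ≠ 0 := by rw [← heq]; exact pow_ne_zero 2 hη
  obtain ⟨h', e⟩ := exists_two_nsmul_eq h hη
  rw [succ_nsmul', e]
  have hA : tripleNum W x = x * psiThree W x ^ 2 +
    8 * cubic W x * (8 * cubic W x ^ 2 - cubicDeriv W x * psiThree W x) := rfl
  have hC : tripleFac W x = -psiThree W x ^ 3 -
    4 * (16 * cubic W x ^ 2 - cubicDeriv W x * psiThree W x) *
    (8 * cubic W x ^ 2 - cubicDeriv W x * psiThree W x) := rfl
  have hm : (centredY W x y - centredY W (x - psiThree W x / (4 * cubic W x))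
      (uncentredY W (x - psiThree W x / (4 * cubic W x)) (-centredY W x y +
        cubicDeriv W x * psiThree W x / (8 * cubic W x * centredY W x y)))) /
      (x - (x - psiThree W x / (4 * cubic W x))) =
      (16 * cubic W x ^ 2 - cubicDeriv W x * psiThree W x) /
        (2 * centredY W x y * psiThree W x) := by
    rw [centredY_uncentredY, sub_sub_cancel]
    field_simp
    linear_combination (128 * cubic W x) * heq
  obtain ⟨h'', e'⟩ := add_eq_of_ne h h' (by
    rw [ne_eq, eq_comm, sub_eq_self]
    exact div_ne_zero hψ (mul_ne_zero h4 hg)) hm rfl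
  rw [e']
  set η := centredY W x y
  set g := cubic W x
  set d := cubicDeriv W x
  set p := psiThree W x
  have hX : ((16 * g ^ 2 - d * p) / (2 * η * p)) ^ 2 - W.b₂ / 4 - x - (x - p / (4 * g)) =
      tripleNum W x / p ^ 2 := by
    rw [hA, div_pow, mul_pow, mul_pow, heq]
    field_simp
    linear_combination (-4 * p ^ 2) * hdef
  have hY : -(η + (16 * g ^ 2 - d * p) / (2 * η * p) * (tripleNum W x / p ^ 2 - x)) =
      η * tripleFac W x / p ^ 3 := by
    rw [hA, hC]
    field_simp
    rw [heq]
    ring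
  exact exists_some_eq hX (by rw [hX, hY])

end GroupLaw

/-! ### Multiplication by 3 as an odd cover -/

section TripleCover

open Polynomial

variable {K : Type u} [Field K] (E : WeierstrassCurve K)

/-- The derivative of `cubicPoly E`. -/
noncomputable def cubicDerivPoly : K[X] := C 3 * X ^ 2 + C (E.b₂ / 2) * X + C (E.b₄ / 2)

theorem aeval_cubicDerivPoly {F : Type*} [Field F] [Algebra K F] (x : F) :
    aeval x (cubicDerivPoly E) = cubicDeriv (E.baseChange F) x := by
  simp [cubicDerivPoly, cubicDeriv, WeierstrassCurve.baseChange, map_b₂, map_b₄, map_ofNat]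

variable [NeZero (2 : K)]

theorem Ψ₃_eq : E.Ψ₃ = (C 12 * X + C E.b₂) * cubicPoly E - cubicDerivPoly E ^ 2 := by
  have h2 : (2 : K) ≠ 0 := two_ne_zero
  have h4 : (4 : K) ≠ 0 := four_ne_zero_of_neZero_two
  have e2 : C (E.b₂ / 2) = 2 * C (E.b₂ / 4) := by
    rw [← C_ofNat, ← C_mul]; congr 1; field_simp; norm_num
  have f2 : C E.b₂ = 4 * C (E.b₂ / 4) := by
    rw [← C_ofNat, ← C_mul]; congr 1; field_simp
  have f4 : C E.b₄ = 2 * C (E.b₄ / 2) := by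
    rw [← C_ofNat, ← C_mul]; congr 1; field_simp
  have f6 : C E.b₆ = 4 * C (E.b₆ / 4) := by
    rw [← C_ofNat, ← C_mul]; congr 1; field_simp
  have f8 : C E.b₈ = 4 * C (E.b₂ / 4) * C (E.b₆ / 4) - C (E.b₄ / 2) ^ 2 := by
    rw [← C_ofNat, ← C_mul, ← C_mul, ← C_pow, ← C_sub]; congr 1
    apply mul_left_cancel₀ h4
    have := E.b_relation
    field_simp
    linear_combination 4 * this
  rw [Ψ₃, cubicPoly, cubicDerivPoly, e2, f2, f4, f6, f8, C_ofNat, C_ofNat]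
  ring

theorem aeval_Ψ₃ {F : Type*} [Field F] [Algebra K F] (x : F) :
    aeval x E.Ψ₃ = psiThree (E.baseChange F) x := by
  rw [Ψ₃_eq, psiThree, ← aeval_cubicPoly, ← aeval_cubicDerivPoly]
  simp [WeierstrassCurve.baseChange, map_b₂, map_ofNat]

/-- `x ψ₃² + 8 g (8 g² - g' ψ₃)`. -/
noncomputable def tripleNumPoly : K[X] :=
  X * E.Ψ₃ ^ 2 + 8 * cubicPoly E * (8 * cubicPoly E ^ 2 - cubicDerivPoly E * E.Ψ₃)

/-- `-ψ₃³ - 4 (16 g² - g' ψ₃) (8 g² - g' ψ₃)`. -/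
noncomputable def tripleFacPoly : K[X] :=
  -E.Ψ₃ ^ 3 - 4 * (16 * cubicPoly E ^ 2 - cubicDerivPoly E * E.Ψ₃) *
    (8 * cubicPoly E ^ 2 - cubicDerivPoly E * E.Ψ₃)

theorem aeval_tripleNumPoly {F : Type*} [Field F] [Algebra K F] (x : F) :
    aeval x (tripleNumPoly E) = tripleNum (E.baseChange F) x := by
  simp [tripleNumPoly, tripleNum, ← aeval_cubicPoly, ← aeval_cubicDerivPoly, ← aeval_Ψ₃, map_ofNat]

theorem aeval_tripleFacPoly {F : Type*} [Field F] [Algebra K F] (x : F) :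
    aeval x (tripleFacPoly E) = tripleFac (E.baseChange F) x := by
  simp [tripleFacPoly, tripleFac, ← aeval_cubicPoly, ← aeval_cubicDerivPoly, ← aeval_Ψ₃, map_ofNat]

omit [NeZero (2 : K)] in
-- The leading coefficient is 3² + 8(8 − 3·3) = 1, so no cancellation depends on the characteristic.
theorem natDegree_tripleNumPoly : (tripleNumPoly E).natDegree = 9 := by
  have e : tripleNumPoly E = X * E.Ψ₃ ^ 2 +
      C 8 * cubicPoly E * (C 8 * cubicPoly E ^ 2 - cubicDerivPoly E * E.Ψ₃) := by
    rw [tripleNumPoly, C_ofNat]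
  rw [e, cubicPoly, cubicDerivPoly, Ψ₃]
  compute_degree!

variable [E.IsElliptic] [NeZero (3 : K)]

theorem isCoprime_cubicPoly_cubicDerivPoly : IsCoprime (cubicPoly E) (cubicDerivPoly E) := by
  have h2 : (2 : K) ≠ 0 := two_ne_zero
  have h3 : (3 : K) ≠ 0 := NeZero.ne 3
  have h4 : (4 : K) ≠ 0 := four_ne_zero_of_neZero_two
  set a := E.b₂ / 4 with ha
  set b := E.b₄ / 2 with hb
  set c := E.b₆ / 4 with hc
  -- Euclidean algorithm: 9g = (3x + a)g' + (px + q), and then p²g' = (3px + 2ap − 3q)(px + q) + D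
  -- with D = bp² − 2apq + 3q², where 16D = −9Δ.
  set p := 6 * b - 2 * a ^ 2 with hp
  set q := 9 * c - a * b with hq
  have hN : 16 * (b * p ^ 2 - 2 * a * p * q + 3 * q ^ 2) = -9 * E.Δ := by
    have f2 : E.b₂ = 4 * a := by rw [ha]; field_simp
    have f4 : E.b₄ = 2 * b := by rw [hb]; field_simp
    have f6 : E.b₆ = 4 * c := by rw [hc]; field_simp
    have f8 : E.b₈ = 4 * a * c - b ^ 2 := by
      apply mul_left_cancel₀ h4
      rw [E.b_relation, f2, f4, f6]
      ring
    rw [WeierstrassCurve.Δ, f2, f4, f6, f8, hp, hq]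
    ring
  have hN0 : b * p ^ 2 - 2 * a * p * q + 3 * q ^ 2 ≠ 0 := by
    intro h
    rw [h, mul_zero, eq_comm, mul_eq_zero] at hN
    rcases hN with h | h
    · have : (3 : K) * 3 = 0 := by linear_combination -h
      simp [h3] at this
    · exact E.isUnit_Δ.ne_zero h
  have e2 : E.b₂ / 2 = 2 * a := by rw [ha]; field_simp; norm_num
  rw [cubicPoly, cubicDerivPoly, ← ha, ← hb, ← hc, e2]
  set D := b * p ^ 2 - 2 * a * p * q + 3 * q ^ 2 with hD
  have hinv : C D⁻¹ * C D = 1 := by rw [← C_mul, inv_mul_cancel₀ hN0, C_1]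
  have key : -9 * (C (3 * p) * X + C (2 * a * p - 3 * q)) * (X ^ 3 + C a * X ^ 2 + C b * X + C c) +
      (C (p ^ 2) + (C (3 * p) * X + C (2 * a * p - 3 * q)) * (3 * X + C a)) *
        (C 3 * X ^ 2 + C (2 * a) * X + C b) = C D := by
    rw [hD, hp, hq]
    simp only [map_sub, map_add, map_mul, map_pow, C_ofNat]
    ring
  refine ⟨C D⁻¹ * (-9 * (C (3 * p) * X + C (2 * a * p - 3 * q))), C D⁻¹ *
    (C (p ^ 2) + (C (3 * p) * X + C (2 * a * p - 3 * q)) * (3 * X + C a)), ?_⟩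
  linear_combination C D⁻¹ * key + hinv

/-- Modulo ψ₃ the numerator is 64g³, and g is coprime to ψ₃ because ψ₃ ≡ −g'² modulo g. -/
theorem isCoprime_tripleNumPoly : IsCoprime (tripleNumPoly E) E.Ψ₃ := by
  have h2 : (2 : K) ≠ 0 := two_ne_zero
  have h1 : IsCoprime (cubicPoly E) E.Ψ₃ := by
    have := ((isCoprime_cubicPoly_cubicDerivPoly E).pow_right (n := 2)).neg_right
    have := this.add_mul_left_right (C 12 * X + C E.b₂)
    rwa [neg_add_eq_sub, mul_comm, ← Ψ₃_eq] at this
  have h64 : IsUnit (64 : K[X]) := by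
    rw [← C_ofNat, isUnit_C, isUnit_iff_ne_zero, show (64 : K) = 2 ^ 6 by norm_num]
    exact pow_ne_zero 6 h2
  have h := ((isCoprime_mul_unit_left_left h64 _ _).mpr (h1.pow_left (m := 3))).add_mul_right_left
    (X * E.Ψ₃ - 8 * cubicPoly E * cubicDerivPoly E)
  have e : tripleNumPoly E = 64 * cubicPoly E ^ 3 +
      (X * E.Ψ₃ - 8 * cubicPoly E * cubicDerivPoly E) * E.Ψ₃ := by
    rw [tripleNumPoly]; ring
  rwa [e]

omit [NeZero (2 : K)] [E.IsElliptic] [NeZero (3 : K)] in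
-- The right-hand side is p⁶·g(x + δ) with δ = 8g(8g² − dp)/p². Expanding g at x, the quadratic
-- coefficient 3x + a is eliminated by 4(3x + a)g = p + d².
theorem tripling_identity {R : Type*} [CommRing R] {x a b c g d p : R}
    (hg : g = x ^ 3 + a * x ^ 2 + b * x + c) (hd : d = 3 * x ^ 2 + 2 * a * x + b)
    (hp : p = (12 * x + 4 * a) * g - d ^ 2) :
    g * (-p ^ 3 - 4 * (16 * g ^ 2 - d * p) * (8 * g ^ 2 - d * p)) ^ 2 =
      (x * p ^ 2 + 8 * g * (8 * g ^ 2 - d * p)) ^ 3 +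
        a * (x * p ^ 2 + 8 * g * (8 * g ^ 2 - d * p)) ^ 2 * p ^ 2 +
        b * (x * p ^ 2 + 8 * g * (8 * g ^ 2 - d * p)) * p ^ 4 + c * p ^ 6 := by
  linear_combination p ^ 6 * hg + p ^ 4 * (8 * g * (8 * g ^ 2 - d * p)) * hd +
    16 * g * (8 * g ^ 2 - d * p) ^ 2 * p ^ 2 * hp

/-- Multiplication by `3` as an odd cover. -/
noncomputable def tripleCover : OddCover E E where
  num := tripleNumPoly E
  den := E.Ψ₃
  fac := tripleFacPoly E
  natDegree_num := by rw [natDegree_tripleNumPoly, natDegree_Ψ₃ _ (NeZero.ne 3)]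
  natDegree_den := by rw [natDegree_Ψ₃ _ (NeZero.ne 3)]; norm_num
  coprime := isCoprime_tripleNumPoly E
  equation := by
    have e2 : C (E.b₂ / 2) = 2 * C (E.b₂ / 4) := by
      have h2 : (2 : K) ≠ 0 := two_ne_zero
      have h4 : (4 : K) ≠ 0 := four_ne_zero_of_neZero_two
      rw [← C_ofNat, ← C_mul]; congr 1; field_simp; norm_num
    have f2 : C E.b₂ = 4 * C (E.b₂ / 4) := by
      have h4 : (4 : K) ≠ 0 := four_ne_zero_of_neZero_two
      rw [← C_ofNat, ← C_mul]; congr 1; field_simp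
    refine tripling_identity rfl ?_ ?_
    · rw [cubicDerivPoly, e2, C_ofNat]
    · rw [Ψ₃_eq, f2, C_ofNat]

variable {E} in
theorem three_nsmul_eq_pointMap {F : Type*} [Field F] [DecidableEq F] [Algebra K F] {x y : F}
    (h : (E.baseChange F).toAffine.Nonsingular x y) (hη : centredY (E.baseChange F) x y ≠ 0) :
    3 • Affine.Point.some x y h = (tripleCover E).pointMap F (.some x y h) := by
  have : NeZero (2 : F) := neZero_two_of_algebra K F
  have hden : aeval x (tripleCover E).den = psiThree (E.baseChange F) x := aeval_Ψ₃ E x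
  by_cases hψ : psiThree (E.baseChange F) x = 0
  · rw [three_nsmul_eq_zero h hη hψ, OddCover.pointMap_of_eq_zero _ h (hden.trans hψ)]
  · obtain ⟨h₁, e₁⟩ := exists_three_nsmul_eq h hη hψ
    obtain ⟨h₂, e₂⟩ := (tripleCover E).exists_pointMap_of_ne_zero h (by rwa [hden])
    rw [e₁, e₂]
    have hX : (tripleCover E).mapX x =
        tripleNum (E.baseChange F) x / psiThree (E.baseChange F) x ^ 2 := by
      rw [← aeval_tripleNumPoly, ← aeval_Ψ₃]; rfl
    have hY : (tripleCover E).mapY x y = uncentredY (E.baseChange F)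
        (tripleNum (E.baseChange F) x / psiThree (E.baseChange F) x ^ 2)
        (centredY (E.baseChange F) x y * tripleFac (E.baseChange F) x /
          psiThree (E.baseChange F) x ^ 3) := by
      rw [← hX, ← aeval_tripleFacPoly, ← aeval_Ψ₃]; rfl
    exact some_congr hX.symm hY.symm

end TripleCover

/-! ### The 3-isogenous curve and the dual isogeny -/

section ThreeIsogeny

open Polynomial

/-- Up to the factor 729x⁶ this says that u = A/(9x²), with A the cubed expression on the right, is
the first coordinate of a point of η² = u³ + d(au + 1)². Hence the denominator 3X in `Flex.cover`.
-/
theorem three_isogeny_identity {R : Type*} [CommRing R] {x a b d : R}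
    (hb : 9 * b = 27 - 4 * a ^ 3 * d) :
    (x ^ 3 - 3 * d * (a * x + b) ^ 2) * (x ^ 3 + 12 * d * b * (a * x + 2 * b)) ^ 2 =
      (x ^ 3 - 4 * d * (a ^ 2 * x ^ 2 + 3 * a * b * x + 3 * b ^ 2)) ^ 3 +
      9 * d * x ^ 2 * (a * (x ^ 3 - 4 * d * (a ^ 2 * x ^ 2 + 3 * a * b * x + 3 * b ^ 2)) +
        9 * x ^ 2) ^ 2 := by
  linear_combination -x ^ 3 * (-3 * d * (2 * (a * x + b) + b + 9) * x ^ 3 +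
    4 * d ^ 2 * (a * x) * (18 * b ^ 2 + 18 * b * (a * x) + 5 * (a * x) ^ 2)) * hb

variable {K : Type u} [Field K]

/-- The data of a flex at `x₀` of a Weierstrass curve `η² = (x - x₀)³ + d (a (x - x₀) + 1)²`. -/
structure Flex (E : WeierstrassCurve K) where
  x₀ : K
  d : K
  a : K
  d_ne_zero : d ≠ 0
  b₂_eq : E.b₂ = 4 * (d * a ^ 2 - 3 * x₀)
  b₄_eq : E.b₄ = 2 * (3 * x₀ ^ 2 + 2 * d * a * (1 - a * x₀))
  b₆_eq : E.b₆ = 4 * (-x₀ ^ 3 + d * (1 - a * x₀) ^ 2)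

namespace Flex

variable {E : WeierstrassCurve K} (f : Flex E)

/-- The constant `β` of the `3`-isogenous curve `Y² = X³ - 3 d (a X + β)²`. -/
noncomputable def beta : K := (27 - 4 * f.a ^ 3 * f.d) / 9

/-- The `3`-isogenous curve `Y² = X³ - 3 d (a X + β)²`. -/
noncomputable def isogenous : WeierstrassCurve K :=
  ⟨0, -3 * f.d * f.a ^ 2, 0, -6 * f.d * f.a * f.beta, -3 * f.d * f.beta ^ 2⟩

variable [NeZero (2 : K)] [NeZero (3 : K)]

omit [NeZero (2 : K)] in
theorem nine_mul_beta : 9 * f.beta = 27 - 4 * f.a ^ 3 * f.d := by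
  have h9 : (9 : K) ≠ 0 := by
    rw [show (9 : K) = 3 ^ 2 by norm_num]; exact pow_ne_zero 2 (NeZero.ne 3)
  rw [beta]; field_simp

/-- Δ = −144d²β, so β = 0 would make E singular. -/
theorem beta_ne_zero [E.IsElliptic] : f.beta ≠ 0 := by
  intro h
  have h1 := f.nine_mul_beta
  rw [h, mul_zero] at h1
  apply E.isUnit_Δ.ne_zero
  have h8 : E.b₈ = 4 * (f.d * f.a ^ 2 - 3 * f.x₀) * (-f.x₀ ^ 3 + f.d * (1 - f.a * f.x₀) ^ 2) -
      (3 * f.x₀ ^ 2 + 2 * f.d * f.a * (1 - f.a * f.x₀)) ^ 2 := by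
    apply mul_left_cancel₀ (four_ne_zero_of_neZero_two (F := K))
    rw [E.b_relation, f.b₂_eq, f.b₄_eq, f.b₆_eq]
    ring
  rw [WeierstrassCurve.Δ, h8, f.b₂_eq, f.b₄_eq, f.b₆_eq]
  linear_combination (16 * f.d ^ 2) * h1

theorem isElliptic_isogenous [E.IsElliptic] : f.isogenous.IsElliptic := by
  have h2 : (2 : K) ≠ 0 := two_ne_zero
  have h3 : (3 : K) ≠ 0 := NeZero.ne 3
  have hΔ : f.isogenous.Δ = -(2 ^ 4 * 3 ^ 6 * f.d ^ 2 * f.beta ^ 3) := by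
    simp only [isogenous, WeierstrassCurve.Δ, b₂, b₄, b₆, b₈]
    linear_combination (-432 * f.d ^ 2 * f.beta ^ 3) * f.nine_mul_beta
  refine ⟨isUnit_iff_ne_zero.mpr ?_⟩
  rw [hΔ, neg_ne_zero]
  have := f.beta_ne_zero
  have := f.d_ne_zero
  positivity

/-- The dual `3`-isogeny as an odd cover. -/
noncomputable def cover [E.IsElliptic] : OddCover f.isogenous E where
  num := X ^ 3 + C (9 * f.x₀ - 4 * f.d * f.a ^ 2) * X ^ 2 - C (12 * f.d * f.a * f.beta) * X -
    C (12 * f.d * f.beta ^ 2)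
  den := C 3 * X
  fac := X ^ 3 + C (12 * f.d * f.a * f.beta) * X + C (24 * f.d * f.beta ^ 2)
  natDegree_num := by
    rw [natDegree_C_mul_X _ (NeZero.ne 3)]
    compute_degree!
  natDegree_den := by rw [natDegree_C_mul_X _ (NeZero.ne 3)]
  coprime := by
    have h2 : (2 : K) ≠ 0 := two_ne_zero
    have h3 : (3 : K) ≠ 0 := NeZero.ne 3
    have hc : -(12 * f.d * f.beta ^ 2) ≠ 0 := by
      rw [neg_ne_zero, show (12 : K) = 2 ^ 2 * 3 by norm_num]
      have := f.beta_ne_zero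
      have := f.d_ne_zero
      simp [*]
    rw [isCoprime_mul_unit_left_right (isUnit_C.mpr (isUnit_iff_ne_zero.mpr h3))]
    have h1 : IsCoprime (C (-(12 * f.d * f.beta ^ 2))) (X : K[X]) :=
      ⟨C (-(12 * f.d * f.beta ^ 2))⁻¹, 0, by rw [← C_mul, inv_mul_cancel₀ hc]; simp⟩
    have h4 := h1.add_mul_right_left
      (X ^ 2 + C (9 * f.x₀ - 4 * f.d * f.a ^ 2) * X - C (12 * f.d * f.a * f.beta))
    have e : X ^ 3 + C (9 * f.x₀ - 4 * f.d * f.a ^ 2) * X ^ 2 - C (12 * f.d * f.a * f.beta) * X -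
        C (12 * f.d * f.beta ^ 2) = C (-(12 * f.d * f.beta ^ 2)) +
        (X ^ 2 + C (9 * f.x₀ - 4 * f.d * f.a ^ 2) * X - C (12 * f.d * f.a * f.beta)) * X := by
      rw [C_neg]; ring
    rwa [e]
  equation := by
    have h4 : (4 : K) ≠ 0 := four_ne_zero_of_neZero_two
    have h2 : (2 : K) ≠ 0 := two_ne_zero
    have hb : 9 * C f.beta = 27 - 4 * C f.a ^ 3 * C f.d := by
      have := congrArg (C : K → K[X]) f.nine_mul_beta
      simpa [C_ofNat] using this
    have h := three_isogeny_identity (x := X) hb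
    rw [cubicPoly, f.b₂_eq, f.b₄_eq, f.b₆_eq, mul_div_cancel_left₀ _ h4, mul_div_cancel_left₀ _ h2,
      mul_div_cancel_left₀ _ h4]
    have e2 : f.isogenous.b₂ / 4 = -3 * f.d * f.a ^ 2 := by
      simp only [isogenous, b₂]; field_simp; ring
    have e4 : f.isogenous.b₄ / 2 = -6 * f.d * f.a * f.beta := by
      simp only [isogenous, b₄]; field_simp; ring
    have e6 : f.isogenous.b₆ / 4 = -3 * f.d * f.beta ^ 2 := by
      simp only [isogenous, b₆]; field_simp; ring
    rw [e2, e4, e6]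
    simp only [C_mul, C_sub, C_add, C_pow, C_neg, C_ofNat, C_1]
    linear_combination h

end Flex

end ThreeIsogeny

/-! ### The quotient by a flex, and its compatibility with tripling -/

section FlexMap

variable {F : Type*} [Field F]

/-- The `x`-coordinate of the `3`-isogeny from `η² = u³ + d (a u + 1)²`. -/
def flexX (d a u : F) : F := u + 4 * d * a ^ 2 / 3 + 4 * d * (a * u + 1) / u ^ 2

/-- The `y`-coordinate of the `3`-isogeny from `η² = u³ + d (a u + 1)²`. -/
def flexY (d a u η : F) : F := η * (1 - 4 * d * (a * u + 2) / u ^ 3)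

variable [NeZero (2 : F)] [NeZero (3 : F)]

omit [NeZero (2 : F)] in
theorem flex_equation {d a b u η : F} (hu : u ≠ 0) (h : η ^ 2 = u ^ 3 + d * (a * u + 1) ^ 2)
    (hb : 9 * b = 27 - 4 * a ^ 3 * d) :
    flexY d a u η ^ 2 = flexX d a u ^ 3 - 3 * d * (a * flexX d a u + b) ^ 2 := by
  have h3 : (3 : F) ≠ 0 := NeZero.ne 3
  have h9 : (9 : F) ≠ 0 := by
    rw [show (9 : F) = 3 ^ 2 by norm_num]; exact pow_ne_zero 2 h3
  obtain rfl : b = (27 - 4 * a ^ 3 * d) / 9 := by rw [← hb]; field_simp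
  rw [flexY, flexX, mul_pow, h]
  field_simp
  ring

/-- Invariance of the quotient map under translation by the flex (0, t). With p, q = η ∓ t(au + 1)
the curve becomes pq = u³, and the translate is u' = −2tp/u², η' = t(p − 2t)/q. -/
theorem flex_translate {t a u η m u' η' : F} (hu : u ≠ 0) (ht : t ≠ 0)
    (h : η ^ 2 = u ^ 3 + t ^ 2 * (a * u + 1) ^ 2) (hm : m = (η - t) / u)
    (hu' : u' = m ^ 2 - t ^ 2 * a ^ 2 - u) (hη' : η' = -(η + m * (u' - u))) :
    flexX (t ^ 2) a u' = flexX (t ^ 2) a u ∧ flexY (t ^ 2) a u' η' = flexY (t ^ 2) a u η := by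
  have h2 : (2 : F) ≠ 0 := two_ne_zero
  have h3 : (3 : F) ≠ 0 := NeZero.ne 3
  obtain ⟨p, hp⟩ : ∃ p, p = η - t * (a * u + 1) := ⟨_, rfl⟩
  obtain ⟨q, hq⟩ : ∃ q, q = η + t * (a * u + 1) := ⟨_, rfl⟩
  have hpq : p * q = u ^ 3 := by rw [hp, hq]; linear_combination h
  have hpq0 : p * q ≠ 0 := by rw [hpq]; exact pow_ne_zero 3 hu
  have hp0 := left_ne_zero_of_mul hpq0
  have hq0 := right_ne_zero_of_mul hpq0
  have ha : a = (q - p - 2 * t) / (2 * t * u) := by rw [hp, hq]; field_simp; ring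
  have hη : η = (p + q) / 2 := by rw [hp, hq]; field_simp; ring
  clear hp hq h
  subst ha hη
  have hu'' : u' = -2 * t * p / u ^ 2 := by
    rw [hu', hm]
    field_simp
    linear_combination 4 * hpq
  have hη'' : η' = t * (p - 2 * t) / q := by
    rw [hη', hm, hu'']
    field_simp
    linear_combination (2 * t * (p + q - 2 * t)) * hpq
  clear hu' hη' hm
  subst hu'' hη''
  constructor
  · rw [flexX, flexX]
    field_simp
    linear_combination (-(24 * p * t + 12 * u ^ 3)) * hpq
  · rw [flexY, flexY]
    field_simp
    linear_combination (-((8 * p - 16 * t) * u ^ 6 +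
      (-8 * p * t * q - 16 * p * t ^ 2 + 4 * p ^ 2 * q + 4 * p ^ 3) * u ^ 3 +
      (-16 * p ^ 3 * t ^ 2 + 8 * p ^ 4 * t - 8 * p ^ 2 * t * q ^ 2 - 16 * p ^ 2 * q * t ^ 2))) * hpq

end FlexMap

namespace Flex

open Polynomial

variable {K : Type u} [Field K] [NeZero (2 : K)] [NeZero (3 : K)] {E : WeierstrassCurve K}
  (f : Flex E) {F : Type*} [Field F] [Algebra K F]

omit [NeZero (2 : K)] [NeZero (3 : K)] in
theorem b₂_baseChange : (E.baseChange F).b₂ =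
    4 * (algebraMap K F f.d * algebraMap K F f.a ^ 2 - 3 * algebraMap K F f.x₀) := by
  simp [WeierstrassCurve.baseChange, map_b₂, f.b₂_eq, map_ofNat]

omit [NeZero (2 : K)] [NeZero (3 : K)] in
theorem b₄_baseChange : (E.baseChange F).b₄ =
    2 * (3 * algebraMap K F f.x₀ ^ 2 +
      2 * algebraMap K F f.d * algebraMap K F f.a *
        (1 - algebraMap K F f.a * algebraMap K F f.x₀)) := by
  simp [WeierstrassCurve.baseChange, map_b₄, f.b₄_eq, map_ofNat]

omit [NeZero (2 : K)] [NeZero (3 : K)] in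
theorem b₆_baseChange : (E.baseChange F).b₆ =
    4 * (-algebraMap K F f.x₀ ^ 3 +
      algebraMap K F f.d * (1 - algebraMap K F f.a * algebraMap K F f.x₀) ^ 2) := by
  simp [WeierstrassCurve.baseChange, map_b₆, f.b₆_eq, map_ofNat]

omit [NeZero (3 : K)] in
theorem cubic_eq (u : F) : cubic (E.baseChange F) (algebraMap K F f.x₀ + u) =
    u ^ 3 + algebraMap K F f.d * (algebraMap K F f.a * u + 1) ^ 2 := by
  have : NeZero (2 : F) := neZero_two_of_algebra K F
  have h2 : (2 : F) ≠ 0 := two_ne_zero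
  have h4 : (4 : F) ≠ 0 := four_ne_zero_of_neZero_two
  rw [cubic, f.b₂_baseChange, f.b₄_baseChange, f.b₆_baseChange, mul_div_cancel_left₀ _ h4,
    mul_div_cancel_left₀ _ h2, mul_div_cancel_left₀ _ h4]
  ring

omit [NeZero (3 : K)] in
theorem cubicDeriv_eq (u : F) : cubicDeriv (E.baseChange F) (algebraMap K F f.x₀ + u) =
    3 * u ^ 2 + 2 * algebraMap K F f.d * algebraMap K F f.a * (algebraMap K F f.a * u + 1) := by
  have : NeZero (2 : F) := neZero_two_of_algebra K F
  have h2 : (2 : F) ≠ 0 := two_ne_zero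
  rw [cubicDeriv, f.b₂_baseChange, f.b₄_baseChange, mul_div_cancel_left₀ _ h2]
  field_simp
  ring

omit [NeZero (3 : K)] in
-- The root u = 0 is the flex itself, and the cofactor is 3u²·`dualX`. Hence ψ₃ ≠ 0 keeps a point
-- off the kernel and its image off the zero of the denominator 3X of the dual.
theorem psiThree_eq (u : F) : psiThree (E.baseChange F) (algebraMap K F f.x₀ + u) =
    u * (3 * u ^ 3 + 4 * algebraMap K F f.d * (algebraMap K F f.a ^ 2 * u ^ 2 +
      3 * algebraMap K F f.a * u + 3)) := by
  rw [psiThree, f.cubic_eq, f.cubicDeriv_eq, f.b₂_baseChange]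
  ring

/-- The `3`-isogeny with kernel generated by the flex, on coordinates. -/
noncomputable def dualX (x : F) : F :=
  flexX (algebraMap K F f.d) (algebraMap K F f.a) (x - algebraMap K F f.x₀)

/-- The `3`-isogeny with kernel generated by the flex, on coordinates. -/
noncomputable def dualY (x y : F) : F :=
  flexY (algebraMap K F f.d) (algebraMap K F f.a) (x - algebraMap K F f.x₀)
    (centredY (E.baseChange F) x y)

theorem isogenous_equation [E.IsElliptic] {x y : F} (h : (E.baseChange F).toAffine.Nonsingular x y)
    (hx : x ≠ algebraMap K F f.x₀) :
    (f.isogenous.baseChange F).toAffine.Nonsingular (f.dualX x) (f.dualY x y) := by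
  have : NeZero (2 : F) := neZero_two_of_algebra K F
  have : NeZero (3 : F) := ⟨by
    have := (map_ne_zero (algebraMap K F)).mpr (NeZero.ne (3 : K))
    rwa [map_ofNat] at this⟩
  have : f.isogenous.IsElliptic := f.isElliptic_isogenous
  have : (f.isogenous.baseChange F).IsElliptic := inferInstanceAs (f.isogenous.map _).IsElliptic
  rw [← Affine.equation_iff_nonsingular, Affine.equation_iff]
  have heq := (equation_iff_centredY _ _ _).mp h.1
  have hb : 9 * algebraMap K F f.beta =
      27 - 4 * algebraMap K F f.a ^ 3 * algebraMap K F f.d := by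
    have := congrArg (algebraMap K F) f.nine_mul_beta
    simpa [map_ofNat] using this
  have hc := f.cubic_eq (x - algebraMap K F f.x₀)
  rw [add_sub_cancel, ← heq] at hc
  have := flex_equation (sub_ne_zero.mpr hx) hc hb
  simp only [isogenous, WeierstrassCurve.baseChange, map_a₁, map_a₂, map_a₃, map_a₄, map_a₆,
    map_neg, map_mul, map_pow, map_ofNat, map_zero, dualX, dualY] at this ⊢
  linear_combination this

/-- The dual isogeny after the quotient map is [3]; both sides are compared with the explicit
tripling formula. -/
theorem pointMap_dual [E.IsElliptic] [DecidableEq F] {x y : F}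
    (h : (E.baseChange F).toAffine.Nonsingular x y) (hη : centredY (E.baseChange F) x y ≠ 0)
    (hψ : psiThree (E.baseChange F) x ≠ 0)
    (h' : (f.isogenous.baseChange F).toAffine.Nonsingular (f.dualX x) (f.dualY x y)) :
    f.cover.pointMap F (.some _ _ h') = 3 • Affine.Point.some x y h := by
  have : NeZero (2 : F) := neZero_two_of_algebra K F
  have : NeZero (3 : F) := ⟨by
    have := (map_ne_zero (algebraMap K F)).mpr (NeZero.ne (3 : K))
    rwa [map_ofNat] at this⟩
  have h2 : (2 : F) ≠ 0 := two_ne_zero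
  have h3 : (3 : F) ≠ 0 := NeZero.ne 3
  have h9 : (9 : F) ≠ 0 := by
    rw [show (9 : F) = 3 ^ 2 by norm_num]; exact pow_ne_zero 2 h3
  obtain ⟨h₁, e₁⟩ := exists_three_nsmul_eq h hη hψ
  obtain ⟨u, rfl⟩ : ∃ u, x = algebraMap K F f.x₀ + u := ⟨x - algebraMap K F f.x₀, by ring⟩
  have hψ' := f.psiThree_eq u
  rw [hψ'] at hψ
  have hu : u ≠ 0 := left_ne_zero_of_mul hψ
  have hn := right_ne_zero_of_mul hψ
  have hX : f.dualX (algebraMap K F f.x₀ + u) = (3 * u ^ 3 + 4 * algebraMap K F f.d *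
      (algebraMap K F f.a ^ 2 * u ^ 2 + 3 * algebraMap K F f.a * u + 3)) / (3 * u ^ 2) := by
    rw [dualX, flexX, add_sub_cancel_left]
    field_simp
    ring
  have hb : algebraMap K F f.beta =
      (27 - 4 * algebraMap K F f.a ^ 3 * algebraMap K F f.d) / 9 := by
    simp [beta, map_ofNat]
  have hden : aeval (f.dualX (algebraMap K F f.x₀ + u)) f.cover.den ≠ 0 := by
    simp only [cover, map_mul, aeval_X, map_ofNat, hX]
    exact mul_ne_zero h3 (div_ne_zero hn (mul_ne_zero h3 (pow_ne_zero 2 hu)))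
  obtain ⟨h₂, e₂⟩ := f.cover.exists_pointMap_of_ne_zero h' hden
  rw [e₁, e₂]
  have eX : f.cover.mapX (f.dualX (algebraMap K F f.x₀ + u)) =
      tripleNum (E.baseChange F) (algebraMap K F f.x₀ + u) /
        psiThree (E.baseChange F) (algebraMap K F f.x₀ + u) ^ 2 := by
    rw [tripleNum, f.cubic_eq, f.cubicDeriv_eq, hψ', OddCover.mapX, hX]
    simp only [cover, map_mul, map_add, map_sub, map_pow, aeval_C, aeval_X, map_ofNat, hb]
    field_simp
    ring
  refine some_congr eX ?_
  rw [OddCover.mapY, uncentredY, ← eX]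
  congr 1
  have hc : centredY (f.isogenous.baseChange F) (f.dualX (algebraMap K F f.x₀ + u))
      (f.dualY (algebraMap K F f.x₀ + u) y) = f.dualY (algebraMap K F f.x₀ + u) y := by
    simp [centredY, isogenous, WeierstrassCurve.baseChange]
  rw [hc, dualY, flexY, tripleFac, f.cubic_eq, f.cubicDeriv_eq, hψ', hX, add_sub_cancel_left]
  simp only [cover, map_mul, map_add, map_sub, map_pow, aeval_C, aeval_X, map_ofNat, hb]
  field_simp
  ring

/-- Either of the two points above x₀ may be the one added, so this covers translation by T and by
−T. Over F, d is the square of the η-coordinate of that point, as `flex_translate` requires. -/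
theorem exists_add_eq [DecidableEq F] {x y x₀ y₀ : F}
    (h : (E.baseChange F).toAffine.Nonsingular x y)
    (h₀ : (E.baseChange F).toAffine.Nonsingular x₀ y₀) (hx₀ : x₀ = algebraMap K F f.x₀)
    (hx : x ≠ x₀) : ∃ x' y' h', Affine.Point.some x y h + Affine.Point.some x₀ y₀ h₀ =
      Affine.Point.some x' y' h' ∧ f.dualX x' = f.dualX x ∧ f.dualY x' y' = f.dualY x y := by
  have : NeZero (2 : F) := neZero_two_of_algebra K F
  have : NeZero (3 : F) := ⟨by
    have := (map_ne_zero (algebraMap K F)).mpr (NeZero.ne (3 : K))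
    rwa [map_ofNat] at this⟩
  have h4 : (4 : F) ≠ 0 := four_ne_zero_of_neZero_two
  obtain ⟨h', e⟩ := add_eq_of_ne h h₀ hx rfl rfl
  refine ⟨_, _, h', e, ?_⟩
  have ht := (equation_iff_centredY _ _ _).mp h₀.1
  rw [hx₀, ← add_zero (algebraMap K F f.x₀), f.cubic_eq, add_zero] at ht
  have ht' : centredY (E.baseChange F) x₀ y₀ ^ 2 = algebraMap K F f.d := by
    rw [hx₀]; linear_combination ht
  have ht0 : centredY (E.baseChange F) x₀ y₀ ≠ 0 := by
    rw [← pow_ne_zero_iff two_ne_zero, ht']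
    simpa using f.d_ne_zero
  have hη := (equation_iff_centredY _ _ _).mp h.1
  rw [← add_sub_cancel (algebraMap K F f.x₀) x, f.cubic_eq, add_sub_cancel, ← ht'] at hη
  rw [dualX, dualX, dualY, dualY, centredY_uncentredY, ← ht']
  refine flex_translate (m := (centredY (E.baseChange F) x y - centredY (E.baseChange F) x₀ y₀) /
    (x - algebraMap K F f.x₀)) (sub_ne_zero.mpr (hx₀ ▸ hx)) ht0 hη rfl ?_ ?_
  · rw [ht', f.b₂_baseChange, mul_div_cancel_left₀ _ h4, hx₀]
    ring
  · rw [hx₀]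
    ring

end Flex

theorem cubic_baseChange_algebraMap {K F : Type*} [Field K] [Field F] [Algebra K F]
    (E : WeierstrassCurve K) (x : K) :
    cubic (E.baseChange F) (algebraMap K F x) = algebraMap K F (cubic E x) := by
  simp [cubic, WeierstrassCurve.baseChange, map_b₂, map_b₄, map_b₆, map_ofNat]

theorem psiThree_baseChange_algebraMap {K F : Type*} [Field K] [Field F] [Algebra K F]
    (E : WeierstrassCurve K) (x : K) :
    psiThree (E.baseChange F) (algebraMap K F x) = algebraMap K F (psiThree E x) := by
  rw [psiThree, cubic_baseChange_algebraMap]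
  simp [psiThree, cubicDeriv, WeierstrassCurve.baseChange, map_b₂,
    map_b₄, map_ofNat]

/-- Expand g at x₀ with d = g(x₀) and a = g'(x₀)/(2g(x₀)). The constant and linear terms agree with
d(au + 1)² automatically; the quadratic ones agree exactly when 2gg'' = g'² at x₀, that is, when ψ₃
vanishes there. -/
theorem exists_flex {K : Type u} [Field K] [NeZero (2 : K)] (E : WeierstrassCurve K) {x₀ : K}
    (hψ : psiThree E x₀ = 0) (h0 : cubic E x₀ ≠ 0) : ∃ f : Flex E, f.x₀ = x₀ := by
  have h2 : (2 : K) ≠ 0 := two_ne_zero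
  have h4 : (4 : K) ≠ 0 := four_ne_zero_of_neZero_two
  have ha : 2 * cubic E x₀ * (cubicDeriv E x₀ / (2 * cubic E x₀)) = cubicDeriv E x₀ := by
    field_simp
  have hb : 4 * (cubic E x₀ * (cubicDeriv E x₀ / (2 * cubic E x₀)) ^ 2) = 12 * x₀ + E.b₂ := by
    rw [psiThree, sub_eq_zero] at hψ
    field_simp
    linear_combination (-4 : K) * hψ
  have hd : 4 * cubic E x₀ = 4 * x₀ ^ 3 + E.b₂ * x₀ ^ 2 + 2 * E.b₄ * x₀ + E.b₆ := by
    rw [cubic]; field_simp; ring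
  have hd' : 2 * cubicDeriv E x₀ = 6 * x₀ ^ 2 + E.b₂ * x₀ + E.b₄ := by
    rw [cubicDeriv]; field_simp; ring
  refine ⟨⟨x₀, cubic E x₀, cubicDeriv E x₀ / (2 * cubic E x₀), h0, ?_, ?_, ?_⟩, rfl⟩
  · linear_combination -hb
  · linear_combination x₀ * hb - 2 * ha - hd'
  · linear_combination (4 * x₀) * ha - x₀ ^ 2 * hb - hd + 2 * x₀ * hd'

/-! ### Stable sets of trisections in an abstract group -/

section Trisection

variable {M ι : Type*} [AddCommGroup M] {σ : ι → M →+ M} {P : M}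

theorem image_eq_of_stable [DecidableEq M] (hσ : ∀ i, Function.Injective (σ i)) {O : Finset M}
    (hst : ∀ i, ∀ R ∈ O, σ i R ∈ O) (i : ι) : O.image (σ i) = O := by
  refine Finset.eq_of_subset_of_card_le ?_ ?_
  · intro R hR
    obtain ⟨R', hR', rfl⟩ := Finset.mem_image.mp hR
    exact hst i R' hR'
  · rw [Finset.card_image_of_injective _ (hσ i)]

theorem sum_fixed_of_stable [DecidableEq M] (hσ : ∀ i, Function.Injective (σ i)) {O : Finset M}
    (hst : ∀ i, ∀ R ∈ O, σ i R ∈ O) (i : ι) : σ i (∑ R ∈ O, R) = ∑ R ∈ O, R := by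
  rw [map_sum]
  conv_rhs => rw [← image_eq_of_stable hσ hst i]
  rw [Finset.sum_image fun _ _ _ _ h => hσ i h]

theorem three_nsmul_sum {O : Finset M} (hOP : ∀ R ∈ O, 3 • R = P) :
    3 • ∑ R ∈ O, R = O.card • P := by
  rw [Finset.smul_sum, Finset.sum_congr rfl hOP, Finset.sum_const]

/-- The sum of O is fixed and trisects n·P, n = #O. As n ≡ ±1 mod 3, adding a multiple of P to ±
that sum corrects it to a trisection of P. -/
theorem exists_fixed_of_not_dvd [DecidableEq M] (hσ : ∀ i, Function.Injective (σ i))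
    {O : Finset M} (hOP : ∀ R ∈ O, 3 • R = P) (hst : ∀ i, ∀ R ∈ O, σ i R ∈ O)
    (hP : ∀ i, σ i P = P) (h : ¬ 3 ∣ O.card) : ∃ R, 3 • R = P ∧ ∀ i, σ i R = R := by
  have hsum := three_nsmul_sum hOP
  have hfix := sum_fixed_of_stable hσ hst
  obtain ⟨m, hm | hm⟩ : ∃ m, O.card = 3 * m + 1 ∨ O.card = 3 * m + 2 :=
    ⟨O.card / 3, by omega⟩
  · refine ⟨∑ R ∈ O, R - m • P, ?_, fun i => by rw [map_sub, map_nsmul, hfix, hP]⟩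
    rw [smul_sub, hsum, hm, add_smul, mul_smul, one_smul, add_sub_cancel_left]
  · refine ⟨(m + 1) • P - ∑ R ∈ O, R, ?_, fun i => by rw [map_sub, map_nsmul, hfix, hP]⟩
    rw [smul_sub, hsum, hm, ← mul_smul, show 3 * (m + 1) = 1 + (3 * m + 2) by ring, add_smul,
      one_smul, add_sub_cancel_right]

/-- The difference ΣO − P is a fixed 3-torsion point. If it is zero, then a + b + c = 3a, so the
differences of b and c from a are opposite and O is a line. -/
theorem exists_of_card_eq_three [DecidableEq M] (hσ : ∀ i, Function.Injective (σ i))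
    {O : Finset M} (hOP : ∀ R ∈ O, 3 • R = P) (hst : ∀ i, ∀ R ∈ O, σ i R ∈ O)
    (hP : ∀ i, σ i P = P) (h : O.card = 3) :
    (∃ T, T ≠ 0 ∧ 3 • T = 0 ∧ ∀ i, σ i T = T) ∨
      ∃ R T, T ≠ 0 ∧ 3 • T = 0 ∧ 3 • R = P ∧ ∀ i, (σ i T = T ∨ σ i T = -T) ∧
        (σ i R = R ∨ σ i R = R + T ∨ σ i R = R + -T) := by
  have hsum := three_nsmul_sum hOP
  have hfix := sum_fixed_of_stable hσ hst
  by_cases hD : ∑ R ∈ O, R = P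
  · right
    obtain ⟨a, b, c, hab, hac, hbc, rfl⟩ := Finset.card_eq_three.mp h
    rw [Finset.sum_insert (by simp [hab, hac]), Finset.sum_insert (by simp [hbc]),
      Finset.sum_singleton] at hD
    have ha := hOP a (by simp)
    have hb := hOP b (by simp)
    have hT3 : 3 • (b - a) = 0 := by rw [smul_sub, ha, hb, sub_self]
    have hc : c = a + -(b - a) := by
      have : a + (b + c) = 3 • a := by rw [hD, ha]
      have e : c = 3 • a - a - b := by rw [← this]; abel
      rw [e]; abel
    have hbe : b = a + (b - a) := by abel
    refine ⟨a, b - a, sub_ne_zero.mpr hab.symm, hT3, ha, fun i => ?_⟩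
    generalize b - a = T at *
    have h1 := hst i a (by simp)
    have h2 := hst i b (by simp)
    have hne : σ i a ≠ σ i b := fun h => hab (hσ i h)
    have hTT : T + T = -T := by
      rw [eq_neg_iff_add_eq_zero, ← hT3]; abel
    have hTe : σ i T = σ i b - σ i a := by rw [hbe, map_add, add_sub_cancel_left]
    subst hbe hc
    simp only [Finset.mem_insert, Finset.mem_singleton] at h1 h2
    refine ⟨?_, h1⟩
    rw [hTe]
    -- σT is the difference of two distinct points of the line {a, a + T, a − T}, hence ±T because
    -- 2T = −T.
    rcases h1 with h1 | h1 | h1 <;> rcases h2 with h2 | h2 | h2 <;> rw [h1, h2] at hne ⊢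
    · exact absurd rfl hne
    · left; abel
    · right; abel
    · right; abel
    · exact absurd rfl hne
    · left; rw [← sub_eq_zero, ← neg_eq_zero, ← hT3]; abel
    · left; abel
    · right; rw [show a + T - (a + -T) = T + T by abel, hTT]
    · exact absurd rfl hne
  · left
    refine ⟨∑ R ∈ O, R - P, sub_ne_zero.mpr hD, ?_, fun i => by rw [map_sub, hfix, hP]⟩
    rw [smul_sub, hsum, h, sub_self]

theorem card_eq_nine_of_three_torsion {H : Type*} [AddCommGroup H] [Finite H]
    (h3 : ∀ x : H, 3 • x = 0) (h6 : 6 ≤ Nat.card H) (h9 : Nat.card H ≤ 9) : Nat.card H = 9 := by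
  let _ : Module (ZMod 3) H := AddCommGroup.zmodModule h3
  have := Module.natCard_eq_pow_finrank (K := ZMod 3) (V := H)
  rw [Nat.card_zmod] at this
  rw [this] at h6 h9 ⊢
  generalize Module.finrank (ZMod 3) H = n at *
  rcases n with _ | _ | _ | n
  · norm_num at h6
  · norm_num at h6
  · norm_num
  · have : 3 ^ 3 ≤ 3 ^ (n + 1 + 1 + 1) := Nat.pow_le_pow_right (by norm_num) (by omega)
    omega

/-- Let `O` be a stable set of fewer than nine `P`-trisections in an abelian group with at most nine
`3`-torsion points. Then there is a fixed trisection, or a fixed non-zero `3`-torsion point, or a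
stable line of trisections. -/
theorem exists_fixed_or_line [DecidableEq M] (hσ : ∀ i, Function.Injective (σ i)) {O : Finset M}
    (hne : O.Nonempty) (hcard : O.card < 9) (hOP : ∀ R ∈ O, 3 • R = P)
    (hst : ∀ i, ∀ R ∈ O, σ i R ∈ O) (hP : ∀ i, σ i P = P)
    (htors : ∃ s : Finset M, (∀ T, 3 • T = 0 → T ∈ s) ∧ s.card ≤ 9) :
    (∃ R, 3 • R = P ∧ ∀ i, σ i R = R) ∨ (∃ T, T ≠ 0 ∧ 3 • T = 0 ∧ ∀ i, σ i T = T) ∨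
      ∃ R T, T ≠ 0 ∧ 3 • T = 0 ∧ 3 • R = P ∧ ∀ i, (σ i T = T ∨ σ i T = -T) ∧
        (σ i R = R ∨ σ i R = R + T ∨ σ i R = R + -T) := by
  by_cases hdvd : 3 ∣ O.card
  swap
  · exact .inl (exists_fixed_of_not_dvd hσ hOP hst hP hdvd)
  right
  have hpos := hne.card_pos
  obtain h3 | h6 : O.card = 3 ∨ O.card = 6 := by omega
  · exact exists_of_card_eq_three hσ hOP hst hP h3
  obtain ⟨s, hs, hs9⟩ := htors
  obtain ⟨R₀, hR₀⟩ := hne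
  let H : AddSubgroup M := (nsmulAddMonoidHom (α := M) 3).ker
  have hHmem (T : M) : T ∈ H ↔ 3 • T = 0 := by
    rw [AddMonoidHom.mem_ker, nsmulAddMonoidHom_apply]
  have hHs : (H : Set M) ⊆ s := fun T hT => hs T ((hHmem T).mp hT)
  have hHfin : (H : Set M).Finite := s.finite_toSet.subset hHs
  have : Finite H := hHfin
  let S : Finset M := hHfin.toFinset.image (R₀ + ·)
  have hSmem (R : M) : R ∈ S ↔ 3 • R = P := by
    simp only [S, Finset.mem_image, Set.Finite.mem_toFinset, SetLike.mem_coe, hHmem]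
    constructor
    · rintro ⟨T, hT, rfl⟩
      rw [smul_add, hT, add_zero, hOP R₀ hR₀]
    · intro h
      exact ⟨R - R₀, by rw [smul_sub, h, hOP R₀ hR₀, sub_self], by abel⟩
  have hScard : S.card = Nat.card H := by
    rw [Finset.card_image_of_injective _ (add_right_injective R₀)]
    exact (Nat.card_eq_card_finite_toFinset hHfin).symm
  have hOS : O ⊆ S := fun R hR => (hSmem R).mpr (hOP R hR)
  -- The 3-torsion is an 𝔽₃-vector space with between 6 and 9 elements, so the complement of O among
  -- all trisections has 9 − 6 = 3.
  have hH9 : Nat.card H = 9 := by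
    refine card_eq_nine_of_three_torsion (fun x => Subtype.ext ((hHmem _).mp x.2)) ?_ ?_
    · rw [← hScard, ← h6]; exact Finset.card_le_card hOS
    · rw [← hScard, Finset.card_image_of_injective _ (add_right_injective R₀)]
      refine (Finset.card_le_card ?_).trans hs9
      intro T hT
      exact hHs (hHfin.mem_toFinset.mp hT)
  have hSst (i : ι) (R : M) (hR : R ∈ S) : σ i R ∈ S := by
    rw [hSmem] at hR ⊢
    rw [← map_nsmul, hR, hP]
  refine exists_of_card_eq_three (O := S \ O) hσ
    (fun R hR => (hSmem R).mp (Finset.mem_sdiff.mp hR).1) ?_ hP ?_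
  · intro i R hR
    rw [Finset.mem_sdiff] at hR ⊢
    refine ⟨hSst i R hR.1, fun hO => hR.2 ?_⟩
    rw [← image_eq_of_stable hσ hst i] at hO
    obtain ⟨R', hR', he⟩ := Finset.mem_image.mp hO
    rwa [← hσ i he]
  · rw [Finset.card_sdiff_of_subset hOS, hScard, hH9, h6]

end Trisection

/-! ### 3-torsion points and counting by x-coordinate -/

section Torsion

variable {F : Type*} [Field F] {W : WeierstrassCurve F} [NeZero (2 : F)] [DecidableEq F]

theorem centredY_ne_zero_of_three_nsmul_eq_zero {x y : F} {h : W.toAffine.Nonsingular x y}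
    (h3 : 3 • Affine.Point.some x y h = 0) : centredY W x y ≠ 0 := by
  intro hη
  have h2 := two_nsmul_eq_zero_of_centredY h hη
  refine Affine.Point.some_ne_zero h ?_
  rw [show 3 = 2 + 1 from rfl, add_smul, h2, zero_add, one_smul] at h3
  exact h3

theorem psiThree_eq_zero_of_three_nsmul_eq_zero {x y : F} {h : W.toAffine.Nonsingular x y}
    (h3 : 3 • Affine.Point.some x y h = 0) : psiThree W x = 0 := by
  by_contra hψ
  obtain ⟨h', e⟩ := exists_three_nsmul_eq h (centredY_ne_zero_of_three_nsmul_eq_zero h3) hψ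
  rw [h3] at e
  exact Affine.Point.some_ne_zero h' e.symm

theorem cubic_ne_zero_of_three_nsmul_eq_zero {x y : F} {h : W.toAffine.Nonsingular x y}
    (h3 : 3 • Affine.Point.some x y h = 0) : cubic W x ≠ 0 := by
  rw [← (equation_iff_centredY W x y).mp h.1]
  exact pow_ne_zero 2 (centredY_ne_zero_of_three_nsmul_eq_zero h3)

omit [NeZero (2 : F)] in
/-- A set of `x`-coordinates with at most `n` elements carries at most `2 n + 1` points,
counting the point at infinity. -/
theorem exists_finset_of_xCoord_mem (ρ : Finset F) :
    ∃ s : Finset W.toAffine.Point, 0 ∈ s ∧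
      (∀ x y h, x ∈ ρ → Affine.Point.some x y h ∈ s) ∧ s.card ≤ 2 * ρ.card + 1 := by
  classical
  let c (x : F) : W.toAffine.Point :=
    if h : ∃ y, W.toAffine.Nonsingular x y then .some x h.choose h.choose_spec else 0
  refine ⟨insert 0 (ρ.image c ∪ ρ.image fun x => -c x), Finset.mem_insert_self _ _, ?_, ?_⟩
  · intro x y h hx
    have hex : ∃ y, W.toAffine.Nonsingular x y := ⟨y, h⟩
    have hc : c x = .some x hex.choose hex.choose_spec := dif_pos hex
    refine Finset.mem_insert_of_mem (Finset.mem_union.mpr ?_)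
    obtain e | e := (Affine.Point.X_eq_iff (h₁ := h) (h₂ := hex.choose_spec)).mp rfl
    · exact .inl (Finset.mem_image.mpr ⟨x, hx, hc.trans e.symm⟩)
    · exact .inr (Finset.mem_image.mpr ⟨x, hx, (congrArg _ hc).trans e.symm⟩)
  · have h1 := Finset.card_insert_le (0 : W.toAffine.Point) (ρ.image c ∪ ρ.image fun x => -c x)
    have h2 := Finset.card_union_le (ρ.image c) (ρ.image fun x => -c x)
    have h3 : (ρ.image c).card ≤ ρ.card := Finset.card_image_le
    have h4 : (ρ.image fun x => -c x).card ≤ ρ.card := Finset.card_image_le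
    omega

theorem centredY_ne_zero_and_psiThree_ne_zero {x y : F} {h : W.toAffine.Nonsingular x y}
    (h6 : 2 • 3 • Affine.Point.some x y h ≠ 0) : centredY W x y ≠ 0 ∧ psiThree W x ≠ 0 := by
  have hη : centredY W x y ≠ 0 := by
    intro hη
    rw [smul_comm, two_nsmul_eq_zero_of_centredY h hη, smul_zero] at h6
    exact h6 rfl
  refine ⟨hη, fun hψ => h6 ?_⟩
  rw [three_nsmul_eq_zero h hη hψ, smul_zero]

end Torsion

/-! ### Separability of trisections -/

section TrisectionSeparable

open Polynomial

variable {K : Type*} [Field K] (E : WeierstrassCurve K) [NeZero (2 : K)] [NeZero (3 : K)]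

omit [NeZero (3 : K)] in
theorem derivative_cubicPoly : derivative (cubicPoly E) = cubicDerivPoly E := by
  have h2 : (2 : K) ≠ 0 := two_ne_zero
  have h4 : (4 : K) ≠ 0 := four_ne_zero_of_neZero_two
  have e : C (E.b₂ / 2) = 2 * C (E.b₂ / 4) := by
    rw [← C_ofNat, ← C_mul]; congr 1; field_simp; norm_num
  simp only [cubicPoly, cubicDerivPoly, derivative_add, derivative_mul, derivative_C,
    derivative_X_pow, derivative_X, e]
  simp [map_ofNat]
  ring

omit [NeZero (3 : K)] in
theorem two_mul_derivative_cubicDerivPoly :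
    2 * derivative (cubicDerivPoly E) =
      C 12 * X + C E.b₂ := by
  have h2 : (2 : K) ≠ 0 := two_ne_zero
  have e : C E.b₂ = 2 * C (E.b₂ / 2) := by
    rw [← C_ofNat, ← C_mul]; congr 1; field_simp
  simp only [cubicDerivPoly, derivative_add, derivative_mul, derivative_C,
    derivative_X_pow, derivative_X, e]
  simp [map_ofNat]
  ring

omit [NeZero (3 : K)] in
-- (2gg'' − g'²)' = 2gg''' and g''' = 6.
theorem derivative_Ψ₃ : derivative E.Ψ₃ = 12 * cubicPoly E := by
  have h2 := two_mul_derivative_cubicDerivPoly E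
  have h1 := derivative_cubicPoly E
  rw [Ψ₃_eq, derivative_sub, derivative_mul, derivative_pow, h1]
  rw [C_ofNat] at h2 ⊢
  simp only [derivative_add, derivative_mul, derivative_C, derivative_X]
  simp [map_ofNat]
  linear_combination (-cubicDerivPoly E) * h2

omit [NeZero (3 : K)] in
-- Cleared of denominators, this is the fact that [3] multiplies the invariant differential dx/η by
-- 3.
theorem derivative_tripleNumPoly :
    derivative (tripleNumPoly E) * E.Ψ₃ -
      2 * tripleNumPoly E * derivative E.Ψ₃ = 3 * tripleFacPoly E := by
  have h := two_mul_derivative_cubicDerivPoly E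
  have hΨ := Ψ₃_eq E
  rw [← h] at hΨ
  have h1 := derivative_cubicPoly E
  rw [derivative_Ψ₃]
  simp only [tripleNumPoly, tripleFacPoly, derivative_add, derivative_sub, derivative_mul,
    derivative_pow, derivative_Ψ₃, h1]
  simp [map_ofNat]
  linear_combination (4 * E.Ψ₃ ^ 2) * hΨ

/-- ψ₃ has degree 4, each root carries at most two points, and infinity is the ninth. -/
theorem exists_finset_three_torsion (F : Type*) [Field F] [DecidableEq F] [Algebra K F] :
    ∃ s : Finset (E.baseChange F).toAffine.Point, (∀ T, 3 • T = 0 → T ∈ s) ∧ s.card ≤ 9 := by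
  have := neZero_two_of_algebra K F
  obtain ⟨s, h0, hs, hcard⟩ := exists_finset_of_xCoord_mem (W := E.baseChange F)
    (E.Ψ₃.aroots F).toFinset
  refine ⟨s, ?_, hcard.trans ?_⟩
  · rintro (_ | ⟨x, y, h⟩) h3
    · exact h0
    · refine hs x y h ?_
      rw [Multiset.mem_toFinset, Polynomial.mem_aroots]
      exact ⟨E.Ψ₃_ne_zero (NeZero.ne _),
        (aeval_Ψ₃ E x).trans (psiThree_eq_zero_of_three_nsmul_eq_zero h3)⟩
  · have h1 := Multiset.toFinset_card_le (E.Ψ₃.aroots F)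
    have h2 := Polynomial.card_roots' (E.Ψ₃.map (algebraMap K F))
    have h3 := Polynomial.natDegree_map_le (p := E.Ψ₃) (f := algebraMap K F)
    have h4 := E.natDegree_Ψ₃ (NeZero.ne _)
    rw [Polynomial.aroots] at *
    omega

omit [NeZero (2 : K)] [NeZero (3 : K)] in
theorem centredY_baseChange_map {F F' : Type*} [Field F] [Field F'] [Algebra K F] [Algebra K F']
    (f : F →ₐ[K] F') (x y : F) :
    centredY (E.baseChange F') (f x) (f y) = f (centredY (E.baseChange F) x y) := by
  simp [centredY, WeierstrassCurve.baseChange, map_ofNat]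

open IntermediateField in
/-- If `2 P ≠ 0`, then a `P`-trisection over a finite extension is defined over a separable
subextension. -/
theorem exists_separable_trisection [DecidableEq K] {L : Type*} [Field L] [DecidableEq L]
    [Algebra K L] [FiniteDimensional K L] {P : (E.baseChange K).toAffine.Point}
    (hP : 2 • P ≠ 0) {R : (E.baseChange L).toAffine.Point}
    (hR : 3 • R = Affine.Point.baseChange K L P) :
    ∃ (M : IntermediateField K L), Algebra.IsSeparable K M ∧
      ∃ R : (E.baseChange M).toAffine.Point, 3 • R = Affine.Point.baseChange K M P := by
  have := neZero_two_of_algebra K L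
  have h3 : (3 : K) ≠ 0 := NeZero.ne _
  have hP' : 2 • 3 • R ≠ 0 := by
    rw [hR, ← map_nsmul]
    exact (map_ne_zero_iff _ (Affine.Point.map_injective _)).mpr hP
  rcases R with _ | ⟨x, y, h⟩
  · exact absurd (by rw [← Affine.Point.zero_def, smul_zero, smul_zero]) hP'
  rcases P with _ | ⟨xP, yP, hxyP⟩
  · exact absurd (smul_zero 2) hP
  have hηP : centredY (E.baseChange K) xP yP ≠ 0 := fun h =>
    hP (two_nsmul_eq_zero_of_centredY hxyP h)
  obtain ⟨hη, hψ⟩ := centredY_ne_zero_and_psiThree_ne_zero hP'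
  obtain ⟨h', e⟩ := exists_three_nsmul_eq h hη hψ
  have hR' := hR
  rw [e, Affine.Point.baseChange, Affine.Point.map_some, Affine.Point.some.injEq] at hR
  obtain ⟨hx, hy⟩ := hR
  rw [hx] at hy
  have hηη : centredY (E.baseChange L) x y * tripleFac (E.baseChange L) x /
      psiThree (E.baseChange L) x ^ 3 = algebraMap K L (centredY (E.baseChange K) xP yP) := by
    have := congrArg (centredY (E.baseChange L) (Algebra.ofId K L xP)) hy
    rwa [centredY_uncentredY, centredY_baseChange_map] at this
  -- η(P) = η(R)·fac/ψ₃³ is nonzero because 2P ≠ 0.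
  have hC : tripleFac (E.baseChange L) x ≠ 0 := by
    intro hC
    rw [hC, mul_zero, zero_div, eq_comm, map_eq_zero] at hηη
    exact hηP hηη
  rw [div_eq_iff (pow_ne_zero 2 hψ)] at hx
  have hroot : aeval x (tripleNumPoly E - C xP * E.Ψ₃ ^ 2) = 0 := by
    rw [map_sub, map_mul, map_pow, aeval_C, aeval_tripleNumPoly, aeval_Ψ₃, hx]
    exact sub_self _
  -- At x = x(R), ψ₃ times this derivative is 3·fac ≠ 0, so x is a simple root of num − x(P)ψ₃².
  have hder : aeval x (derivative (tripleNumPoly E - C xP * E.Ψ₃ ^ 2)) ≠ 0 := by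
    intro h0
    have key := congrArg (aeval x) (derivative_tripleNumPoly E)
    rw [map_sub, map_mul, map_mul, map_mul, map_mul, aeval_tripleNumPoly, aeval_Ψ₃,
      aeval_tripleFacPoly, hx, map_ofNat, map_ofNat] at key
    rw [derivative_sub, derivative_C_mul, derivative_pow, map_sub, map_mul, aeval_C, map_mul,
      map_mul, map_pow, aeval_Ψ₃, aeval_C, sub_eq_zero] at h0
    rw [h0] at key
    refine mul_ne_zero (a := (3 : L)) ?_ hC ?_
    · rw [← map_ofNat (algebraMap K L)]; exact (_root_.map_ne_zero _).mpr h3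
    · rw [← key]
      simp only [Algebra.ofId_apply, map_ofNat, Nat.cast_ofNat]
      ring
  have hsep : IsSeparable K x := by
    have hint : IsIntegral K x := Algebra.IsIntegral.isIntegral x
    obtain ⟨q, hq⟩ := minpoly.dvd K x hroot
    refine (separable_iff_derivative_ne_zero (minpoly.irreducible hint)).mpr fun h0 => hder ?_
    rw [hq, derivative_mul, h0, zero_mul, zero_add, map_mul, minpoly.aeval, zero_mul]
  have hM : Algebra.IsSeparable K K⟮x⟯ :=
    (isSeparable_adjoin_simple_iff_isSeparable K L).mpr hsep
  let x' : K⟮x⟯ := AdjoinSimple.gen K x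
  have hx' : algebraMap K⟮x⟯ L x' = x := AdjoinSimple.algebraMap_gen K x
  -- Solving η(P) = η(R)·fac/ψ₃³ for η(R) puts the whole point R over K(x).
  obtain ⟨η', hη'⟩ : ∃ η' : K⟮x⟯, algebraMap K⟮x⟯ L η' = centredY (E.baseChange L) x y := by
    refine ⟨algebraMap K K⟮x⟯ (centredY (E.baseChange K) xP yP) * aeval x' E.Ψ₃ ^ 3 /
      aeval x' (tripleFacPoly E), ?_⟩
    rw [map_div₀, map_mul, map_pow, ← aeval_algebraMap_apply, ← aeval_algebraMap_apply, hx',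
      aeval_Ψ₃, aeval_tripleFacPoly, ← IsScalarTower.algebraMap_apply, ← hηη]
    field_simp
  let y' := uncentredY (E.baseChange K⟮x⟯) x' η'
  have hy' : algebraMap K⟮x⟯ L y' = y := by
    rw [← uncentredY_centredY (W := E.baseChange L) x y, ← hη']
    simp only [y', uncentredY, map_sub, map_div₀, map_add, map_mul, map_ofNat, hx',
      WeierstrassCurve.baseChange, map_a₁, map_a₃, ← IsScalarTower.algebraMap_apply]
  have hns : (E.baseChange K⟮x⟯).toAffine.Nonsingular x' y' := by
    rw [← Affine.baseChange_nonsingular E (f := IsScalarTower.toAlgHom K K⟮x⟯ L)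
      (algebraMap K⟮x⟯ L).injective]
    simpa only [IsScalarTower.coe_toAlgHom', hx', hy'] using h
  refine ⟨K⟮x⟯, hM, .some x' y' hns, ?_⟩
  apply Affine.Point.map_injective (IsScalarTower.toAlgHom K K⟮x⟯ L)
  rw [map_nsmul, Affine.Point.map_some, Affine.Point.map_baseChange, ← hR']
  exact congrArg (3 • ·) (some_congr hx' hy')

end TrisectionSeparable

/-! ### Galois descent and conclusion -/

section GaloisDescent

variable {K : Type u} [Field K] [DecidableEq K] (E : WeierstrassCurve K) {F : Type*} [Field F]
  [DecidableEq F] [Algebra K F]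

/-- The action of a `K`-automorphism of `F` on `E(F)`. -/
noncomputable abbrev galMap (g : F ≃ₐ[K] F) :
    (E.baseChange F).toAffine.Point →+ (E.baseChange F).toAffine.Point :=
  Affine.Point.map (W' := E.toAffine) (g : F →ₐ[K] F)

variable {E}

omit [DecidableEq K] in
theorem galMap_some_eq_some_iff {g : F ≃ₐ[K] F} {x y x' y' : F}
    {h : (E.baseChange F).toAffine.Nonsingular x y}
    {h' : (E.baseChange F).toAffine.Nonsingular x' y'} :
    galMap E g (.some x y h) = .some x' y' h' ↔ g x = x' ∧ g y = y' := by
  rw [galMap, Affine.Point.map_some, Affine.Point.some.injEq]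
  rfl

theorem exists_baseChange_eq [IsGalois K F] {Q : (E.baseChange F).toAffine.Point}
    (hQ : ∀ g : F ≃ₐ[K] F, galMap E g Q = Q) :
    ∃ Q₀ : (E.baseChange K).toAffine.Point, Affine.Point.baseChange K F Q₀ = Q := by
  rcases Q with _ | ⟨x, y, h⟩
  · exact ⟨0, map_zero _⟩
  have hfix (g : F ≃ₐ[K] F) : g x = x ∧ g y = y :=
    galMap_some_eq_some_iff.mp (hQ g)
  obtain ⟨x₀, hx⟩ := (InfiniteGalois.mem_bot_iff_fixed x).mpr fun g => (hfix g).1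
  obtain ⟨y₀, hy⟩ := (InfiniteGalois.mem_bot_iff_fixed y).mpr fun g => (hfix g).2
  replace hx : Algebra.ofId K F x₀ = x := hx
  replace hy : Algebra.ofId K F y₀ = y := hy
  subst hx hy
  exact ⟨.some x₀ y₀ ((E.toAffine.baseChange_nonsingular (Algebra.ofId K F).injective _ _).mp h),
    rfl⟩

omit [DecidableEq K] [DecidableEq F] in
theorem Flex.dualX_map (f : Flex E) (g : F ≃ₐ[K] F) (x : F) :
    f.dualX (g x) = g (f.dualX x) := by
  simp [Flex.dualX, flexX, map_ofNat]

omit [DecidableEq K] [DecidableEq F] in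
theorem Flex.dualY_map (f : Flex E) (g : F ≃ₐ[K] F) (x y : F) :
    f.dualY (g x) (g y) = g (f.dualY x y) := by
  have : centredY (E.baseChange F) (g x) (g y) = g (centredY (E.baseChange F) x y) :=
    centredY_baseChange_map E g.toAlgHom x y
  simp [Flex.dualY, flexY, this, map_ofNat]

variable [NeZero (2 : K)] [NeZero (3 : K)] [E.IsElliptic]

theorem isKMagnified_of_three_nsmul {P R : (E.baseChange K).toAffine.Point} (hP : 2 • P ≠ 0)
    (hR : 3 • R = P) : IsKMagnified E P := by
  subst hR
  rcases R with _ | ⟨x, y, h⟩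
  · exact absurd (by rw [← Affine.Point.zero_def, smul_zero, smul_zero]) hP
  rw [three_nsmul_eq_pointMap h (centredY_ne_zero_and_psiThree_ne_zero hP).1]
  exact (tripleCover E).isKMagnified ‹_› _

/-- A stable line `{R, R + T, R - T}` of `P`-trisections yields a `3`-isogeny that magnifies `P`. -/
theorem isKMagnified_of_line [IsGalois K F] {P : (E.baseChange K).toAffine.Point} (hP : 2 • P ≠ 0)
    {R T : (E.baseChange F).toAffine.Point} (hT : T ≠ 0) (hT3 : 3 • T = 0)
    (hR : 3 • R = Affine.Point.baseChange K F P)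
    (hσ : ∀ g : F ≃ₐ[K] F, (galMap E g T = T ∨ galMap E g T = -T) ∧
      (galMap E g R = R ∨ galMap E g R = R + T ∨ galMap E g R = R + -T)) :
    IsKMagnified E P := by
  have := neZero_two_of_algebra K F
  have hP' : 2 • 3 • R ≠ 0 := by
    rw [hR, ← map_nsmul]
    exact (map_ne_zero_iff _ (Affine.Point.map_injective _)).mpr hP
  rcases R with _ | ⟨x, y, h⟩
  · exact absurd (by rw [← Affine.Point.zero_def, smul_zero, smul_zero]) hP'
  rcases T with _ | ⟨t, s, hts⟩
  · exact absurd rfl hT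
  obtain ⟨hη, hψ⟩ := centredY_ne_zero_and_psiThree_ne_zero hP'
  have hψt := psiThree_eq_zero_of_three_nsmul_eq_zero hT3
  have hct := cubic_ne_zero_of_three_nsmul_eq_zero hT3
  -- Conjugates of T are ±T, which share their x-coordinate; so the flex is defined over K even when
  -- T is not.
  have ht (g : F ≃ₐ[K] F) : g t = t := by
    have := (hσ g).1
    rw [galMap, Affine.Point.map_some, ← Affine.Point.X_eq_iff] at this
    exact this
  obtain ⟨t₀, rfl : algebraMap K F t₀ = t⟩ := (InfiniteGalois.mem_bot_iff_fixed t).mpr ht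
  rw [psiThree_baseChange_algebraMap, map_eq_zero] at hψt
  rw [cubic_baseChange_algebraMap, map_ne_zero] at hct
  obtain ⟨f, rfl⟩ := exists_flex E hψt hct
  have hxt : x ≠ algebraMap K F f.x₀ := by
    rintro rfl
    rw [psiThree_baseChange_algebraMap, hψt, map_zero] at hψ
    exact hψ rfl
  let Q : (f.isogenous.baseChange F).toAffine.Point :=
    .some _ _ (f.isogenous_equation h hxt)
  have hdual (g : F ≃ₐ[K] F) : f.dualX (g x) = f.dualX x ∧ f.dualY (g x) (g y) = f.dualY x y := by
    obtain hg | hg | hg := (hσ g).2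
    · rw [galMap_some_eq_some_iff] at hg
      rw [hg.1, hg.2]
      exact ⟨rfl, rfl⟩
    · obtain ⟨x', y', h', e, hX, hY⟩ := f.exists_add_eq h hts rfl hxt
      rw [e, galMap_some_eq_some_iff] at hg
      rw [hg.1, hg.2]
      exact ⟨hX, hY⟩
    · rw [Affine.Point.neg_some] at hg
      obtain ⟨x', y', h', e, hX, hY⟩ := f.exists_add_eq h
        ((Affine.nonsingular_neg _ _).mpr hts) rfl hxt
      rw [e, galMap_some_eq_some_iff] at hg
      rw [hg.1, hg.2]
      exact ⟨hX, hY⟩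
  -- The quotient map has coefficients in K and is constant on the line, so the image of R is
  -- Galois-fixed.
  obtain ⟨Q₀, hQ₀⟩ := exists_baseChange_eq (E := f.isogenous) (Q := Q) fun g =>
    some_congr ((f.dualX_map g x).symm.trans (hdual g).1)
      ((f.dualY_map g x y).symm.trans (hdual g).2)
  have hfP : f.cover.pointMap K Q₀ = P := by
    apply Affine.Point.map_injective (Algebra.ofId K F)
    rw [← hR, ← f.pointMap_dual h hη hψ (f.isogenous_equation h hxt)]
    exact (f.cover.pointMap_baseChange F Q₀).symm.trans (congrArg _ hQ₀)
  rw [← hfP]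
  exact f.cover.isKMagnified f.isElliptic_isogenous Q₀

theorem isKMagnified_or_exists_three_torsion {P : (E.baseChange K).toAffine.Point} (hP : 2 • P ≠ 0)
    {L : Type*} [Field L] [DecidableEq L] [Algebra K L] [FiniteDimensional K L]
    (hL : Module.finrank K L < 9) {R : (E.baseChange L).toAffine.Point}
    (hR : 3 • R = Affine.Point.baseChange K L P) :
    IsKMagnified E P ∨ ∃ T : (E.baseChange K).toAffine.Point, T ≠ 0 ∧ 3 • T = 0 := by
  classical
  obtain ⟨M, hM, R₁, hR₁⟩ := exists_separable_trisection E hP hR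
  let F := SeparableClosure K
  have : Finite (M →ₐ[K] F) := inferInstance
  have := Fintype.ofFinite (M →ₐ[K] F)
  let O : Finset (E.baseChange F).toAffine.Point :=
    Finset.univ.image fun φ : M →ₐ[K] F => Affine.Point.map (W' := E.toAffine) φ R₁
  -- Distinct conjugates come from distinct embeddings of M, of which there are at most [M : K] ≤ [L
  -- : K].
  have hO : O.card < 9 := by
    have h1 : O.card ≤ Fintype.card (M →ₐ[K] F) := Finset.card_image_le
    have h2 := card_algHom_le_finrank K M F
    have h3 : Module.finrank K M ≤ Module.finrank K L :=
      Submodule.finrank_le (Subalgebra.toSubmodule M.toSubalgebra)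
    rw [Nat.card_eq_fintype_card] at h2
    omega
  have hOP : ∀ R ∈ O, 3 • R = Affine.Point.baseChange K F P := by
    intro R hR
    obtain ⟨φ, -, rfl⟩ := Finset.mem_image.mp hR
    rw [← map_nsmul, hR₁, Affine.Point.map_baseChange]
  have hst (g : F ≃ₐ[K] F) : ∀ R ∈ O, galMap E g R ∈ O := by
    intro R hR
    obtain ⟨φ, -, rfl⟩ := Finset.mem_image.mp hR
    exact Finset.mem_image.mpr
      ⟨(g : F →ₐ[K] F).comp φ, Finset.mem_univ _, (Affine.Point.map_map _ _ _).symm⟩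
  -- Separability of M over K provides an embedding into the separable closure.
  have hne : O.Nonempty := ⟨_, Finset.mem_image_of_mem _ (Finset.mem_univ (IsSepClosed.lift))⟩
  obtain ⟨R, hR, hfix⟩ | ⟨T, hT, hT3, hfix⟩ | ⟨R, T, hT, hT3, hR, hσ⟩ :=
    exists_fixed_or_line (σ := galMap (F := F) E) (fun g => Affine.Point.map_injective _) hne hO
      hOP hst (fun g => Affine.Point.map_baseChange _ _) (exists_finset_three_torsion E F)
  · obtain ⟨R₀, rfl⟩ := exists_baseChange_eq hfix
    rw [← map_nsmul] at hR
    exact .inl (isKMagnified_of_three_nsmul hP (Affine.Point.map_injective _ hR))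
  · obtain ⟨T₀, rfl⟩ := exists_baseChange_eq hfix
    refine .inr ⟨T₀, fun h => hT (by rw [h, map_zero]), ?_⟩
    rw [← map_nsmul] at hT3
    exact (map_eq_zero_iff _ (Affine.Point.map_injective _)).mp hT3
  · exact .inl (isKMagnified_of_line hP hT hT3 hR hσ)

end GaloisDescent

end EllIsog

theorem theorem1p3 {K : Type u} [Field K] [DecidableEq K] (hK2 : ringChar K ≠ 2)
    (hK3 : ringChar K ≠ 3) (E : WeierstrassCurve K) [E.IsElliptic]
    (P : (E.baseChange K).toAffine.Point) (hP : ¬ IsOfFinAddOrder P)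
    (hmag : EllIsog.IsMagnifiedByTripling E P) :
    EllIsog.IsKMagnified E P ∨ ∃ T : (E.baseChange K).toAffine.Point, T ≠ 0 ∧ 3 • T = 0 := by
  classical
  have : NeZero (2 : K) := ⟨Ring.two_ne_zero hK2⟩
  have : NeZero (3 : K) := ⟨fun h3 => by
    have hdvd : ringChar K ∣ 3 := (ringChar.spec K 3).mp (by exact_mod_cast h3)
    obtain h1 | h1 := (Nat.dvd_prime Nat.prime_three).mp hdvd
    · exact CharP.ringChar_ne_one h1
    · exact hK3 h1⟩
  have h2P : 2 • P ≠ 0 := fun h =>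
    hP (isOfFinAddOrder_iff_nsmul_eq_zero.mpr ⟨2, two_pos, h⟩)
  obtain ⟨L, _, _, _, hL, R, hR⟩ := hmag
  refine EllIsog.isKMagnified_or_exists_three_torsion h2P hL (R := R) ?_
  convert hR
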